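/- Let $S^2=\mathbb{C}\cup\{\infty\}$ be the Riemann sphere, with north pole $N=\infty$, stereographic coordinate $z$ on $S^2\setminus\{N\}$ and coordinate $w=1/z$ near $N$. Let $L_1,L_2$ be holomorphic line bundles over $S^2$ with $\deg L_2-\deg L_1\ge 2$, and let $D_1'',D_2''$ be their $\bar\partial$-operators. For $j=1,2$ let $\zeta_j$ be a canonical meromorphic section of $L_j$, that is, a section which is holomorphic and nowhere zero on $S^2\setminus\{N\}$ and which near $N$ equals $w^{\deg L_j}$ times a non-vanishing holomorphic local section. Let $\eta$ be a smooth $(0,1)$-form on $S^2$ with values in $\mathrm{Hom}(L_2,L_1)=L_1\otimes L_2^*$, and let $E$ be the smooth bundle $L_1\oplus L_2$ with the holomorphic structure $$D''_\eta=\begin{pmatrix} D_1'' & \eta\\ 0 & D_2''\end{pmatrix}.$$ A meromorphic section of $E$ is a section $\psi$ that is smooth with $D''_\eta\psi=0$ off a finite set and that near each point $x$ of that set equals, off $x$, $c^m\sigma$, where $m\in\mathbb{Z}$, $c$ is a local holomorphic coordinate with $c(x)=0$, and $\sigma$ is a holomorphic local section of $E$ with $\sigma(x)\ne0$. It spans a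 holomorphic line subbundle $J\subset E$ if near every point $x$ one has $\psi=c^m\sigma$ off $x$, for some $m\in\mathbb{Z}$ and some nowhere zero holomorphic local section $\sigma$ whose values span the fibres of $J$ near $x$. Then: 1. There is a smooth function $f:S^2\to\mathbb{C}$ such that $\psi=(f\zeta_1,\zeta_2)$ is a meromorphic section of $E$. 2. For every such $f$, and every holomorphic line subbundle $J\subset E$ with $J\ne L_1$, there is a meromorphic function $h$ on $S^2$ such that $\tilde\psi=((f+h)\zeta_1,\zeta_2)$ is a meromorphic section of $E$ and spans $J$. -/

import Mathlib

open Bundle Filter Topology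
open scoped Manifold ContDiff

noncomputable section

/-! ## The Riemann sphere

The sphere `S²` is `ℂ ∪ {∞}`; the point `∞` is the north pole `N`, `0` is the south pole `S`, and
stereographic projection from `N` is the coordinate `z`. The second coordinate is `w = 1 / z`. -/

/-- The sphere `S²` as a Riemann surface. -/
abbrev RiemannSphere : Type := OnePoint ℂ

namespace RiemannSphere

/-- The coordinate `z` on `S² ∖ {N}`. -/
def zChart : OpenPartialHomeomorph RiemannSphere ℂ where
  toFun x := x.elim 0 id
  invFun z := (z : OnePoint ℂ)
  source := {(OnePoint.infty : OnePoint ℂ)}ᶜ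
  target := Set.univ
  map_source' _ _ := Set.mem_univ _
  map_target' z _ := OnePoint.coe_ne_infty z
  left_inv' x hx := by
    induction x using OnePoint.rec with
    | infty => exact absurd rfl hx
    | coe z => rfl
  right_inv' _ _ := rfl
  open_source := OnePoint.isClosed_infty.isOpen_compl
  open_target := isOpen_univ
  continuousOn_toFun := by
    intro x hx
    induction x using OnePoint.rec with
    | infty => exact absurd rfl hx
    | coe z =>
      refine ContinuousAt.continuousWithinAt (OnePoint.continuousAt_coe.2 ?_)
      exact (continuousAt_id : ContinuousAt (id : ℂ → ℂ) z)
  continuousOn_invFun := OnePoint.continuous_coe.continuousOn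

open Classical in
/-- The coordinate `w = 1 / z` on `S² ∖ {S}`, with `w(N) = 0`. -/
def wChart : OpenPartialHomeomorph RiemannSphere ℂ where
  toFun x := x.elim 0 (fun z => z⁻¹)
  invFun w := if w = 0 then (OnePoint.infty : OnePoint ℂ) else ((w⁻¹ : ℂ) : OnePoint ℂ)
  source := {((0 : ℂ) : OnePoint ℂ)}ᶜ
  target := Set.univ
  map_source' _ _ := Set.mem_univ _
  map_target' w _ := by
    by_cases hw : w = 0
    · simp [hw]
    · simp [hw]
  left_inv' x hx := by
    induction x using OnePoint.rec with
    | infty => simp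
    | coe z =>
      have hz : z ≠ 0 := fun h => hx (by rw [h]; rfl)
      simp [hz]
  right_inv' w _ := by
    by_cases hw : w = 0
    · simp [hw]
    · simp [hw]
  open_source := isClosed_singleton.isOpen_compl
  open_target := isOpen_univ
  continuousOn_toFun := by
    intro x hx
    induction x using OnePoint.rec with
    | infty =>
      refine ContinuousAt.continuousWithinAt ?_
      rw [OnePoint.continuousAt_infty']
      simpa [coclosedCompact_eq_cocompact, ← Metric.cobounded_eq_cocompact, Function.comp_def]
        using (tendsto_inv₀_cobounded (α := ℂ))
    | coe z =>
      have hz : z ≠ 0 := fun h => hx (by rw [h]; rfl)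
      exact (OnePoint.continuousAt_coe.2 (continuousAt_inv₀ hz)).continuousWithinAt
  continuousOn_invFun := by
    rw [continuousOn_univ, continuous_iff_continuousAt]
    intro w
    by_cases hw : w = 0
    · subst hw
      have h1 : Tendsto (fun w : ℂ => ((w⁻¹ : ℂ) : OnePoint ℂ)) (𝓝[≠] 0) (𝓝 OnePoint.infty) := by
        refine OnePoint.tendsto_coe_infty.comp ?_
        rw [coclosedCompact_eq_cocompact, ← Metric.cobounded_eq_cocompact]
        exact tendsto_inv₀_nhdsNE_zero
      rw [continuousAt_iff_punctured_nhds]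
      simp only [if_true]
      refine h1.congr' ?_
      filter_upwards [self_mem_nhdsWithin] with y hy
      rw [if_neg (show y ≠ 0 from hy)]
    · have h2 : ContinuousAt (fun w : ℂ => ((w⁻¹ : ℂ) : OnePoint ℂ)) w :=
        OnePoint.continuous_coe.continuousAt.comp (continuousAt_inv₀ hw)
      refine h2.congr ?_
      filter_upwards [isOpen_ne.mem_nhds hw] with y hy
      rw [if_neg hy]

theorem zChart_symm_apply (z : ℂ) : zChart.symm z = (z : OnePoint ℂ) := rfl

theorem zChart_coe (z : ℂ) : zChart (z : OnePoint ℂ) = z := rfl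

theorem wChart_coe (z : ℂ) : wChart (z : OnePoint ℂ) = z⁻¹ := rfl

theorem wChart_symm_of_ne {w : ℂ} (hw : w ≠ 0) : wChart.symm w = ((w⁻¹ : ℂ) : OnePoint ℂ) :=
  if_neg hw

theorem wChart_symm_zero : wChart.symm 0 = (OnePoint.infty : OnePoint ℂ) := if_pos rfl

open Classical in
/-- The complex atlas `{z, w}` of the Riemann sphere. -/
instance : ChartedSpace ℂ RiemannSphere where
  atlas := {zChart, wChart}
  chartAt x := if x = OnePoint.infty then wChart else zChart
  mem_chart_source x := by
    by_cases hx : x = OnePoint.infty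
    · subst hx
      simp [wChart]
    · simp [hx, zChart]
  chart_mem_atlas x := by
    by_cases hx : x = OnePoint.infty <;> simp [hx]

/-- The Riemann sphere is a complex analytic manifold: the change of coordinates is `z ↦ 1 / z`. -/
instance : IsManifold 𝓘(ℂ) ω RiemannSphere := by
  have key : ContDiffOn ℂ ω (fun z : ℂ => z⁻¹) {(0 : ℂ)}ᶜ := fun z hz =>
    (contDiffAt_inv ℂ hz).contDiffWithinAt
  refine isManifold_of_contDiffOn 𝓘(ℂ) ω RiemannSphere ?_
  intro e e' he he'
  rcases he with rfl | rfl <;> rcases he' with rfl | rfl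
  · exact contDiffOn_id.congr fun z _ => rfl
  · refine (key.mono ?_).congr fun z _ => rfl
    rintro z ⟨⟨-, hz⟩, -⟩
    rintro rfl
    exact hz rfl
  · have h0 : ∀ w : ℂ, w ∈ (wChart.symm.trans zChart).source → w ≠ 0 := by
      rintro w ⟨-, hw⟩ rfl
      exact hw wChart_symm_zero
    refine (key.mono fun w hw => h0 w hw.1).congr fun w hw => ?_
    change zChart (wChart.symm w) = w⁻¹
    rw [wChart_symm_of_ne (h0 w hw.1), zChart_coe]
  · exact contDiffOn_id.congr fun w _ => wChart.right_inv (Set.mem_univ w)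

end RiemannSphere

/-! ## Smooth sections, `∂̄`-operators and meromorphic objects on a Riemann surface

Throughout, a holomorphic line bundle `L` on a Riemann surface `M` is a holomorphic vector bundle
in the sense of Mathlib (`FiberBundle`, `VectorBundle ℂ ℂ L`, `ContMDiffVectorBundle ω ℂ L 𝓘(ℂ)`)
with fibre `ℂ`. -/

section Surface

variable {M : Type*} [TopologicalSpace M] [ChartedSpace ℂ M]

/-- `∂̄u` at `x`: the conjugate-linear part of the real differential of `u : M → ℂ`,
`∂̄u(v) = (du(v) + i du(iv)) / 2`. -/
def dbar (u : M → ℂ) (x : M) (v : TangentSpace 𝓘(ℂ) x) : ℂ :=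
  let du : ℂ → ℂ := fun t => mfderiv 𝓘(ℝ, ℂ) 𝓘(ℝ, ℂ) u x t
  (1 / 2 : ℂ) * (du v + Complex.I * du (Complex.I • v))

/-- A function on `M` is meromorphic if it is so in the local holomorphic coordinates. -/
def IsMeromorphicFunction (h : M → ℂ) : Prop :=
  ∀ x : M, MeromorphicAt (h ∘ (chartAt ℂ x).symm) (chartAt ℂ x x)

section LineBundle

variable {L : M → Type*} [∀ x, AddCommGroup (L x)] [∀ x, Module ℂ (L x)]
  [∀ x, TopologicalSpace (L x)] [TopologicalSpace (TotalSpace ℂ L)] [FiberBundle ℂ L]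

/-- The section `s` of `L` is (real) smooth at `x`. -/
def SmoothSectionAt (s : ∀ x, L x) (x : M) : Prop :=
  ContMDiffAt 𝓘(ℝ, ℂ) (𝓘(ℝ, ℂ).prod 𝓘(ℝ, ℂ)) ∞ (fun y => TotalSpace.mk' ℂ y (s y)) x

/-- The section `s` of `L` is holomorphic in a neighbourhood of `x`. -/
def HolomorphicSectionAt (s : ∀ x, L x) (x : M) : Prop :=
  ContMDiffAt 𝓘(ℂ) (𝓘(ℂ).prod 𝓘(ℂ)) ω (fun y => TotalSpace.mk' ℂ y (s y)) x

/-- The holomorphic structure `D''` of `L`, evaluated on a section `s`, at the point `x` and the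
tangent vector `v`: it is `∂̄` in a local holomorphic trivialization. -/
def dbarSection [VectorBundle ℂ ℂ L] (s : ∀ x, L x) (x : M) (v : TangentSpace 𝓘(ℂ) x) : L x :=
  (trivializationAt ℂ L x).symm x (dbar (fun y => (trivializationAt ℂ L x ⟨y, s y⟩).2) x v)

end LineBundle

section Extension

variable {L₁ L₂ : M → Type*}
  [∀ x, AddCommGroup (L₁ x)] [∀ x, Module ℂ (L₁ x)] [∀ x, TopologicalSpace (L₁ x)]
  [TopologicalSpace (TotalSpace ℂ L₁)] [FiberBundle ℂ L₁] [VectorBundle ℂ ℂ L₁]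
  [∀ x, AddCommGroup (L₂ x)] [∀ x, Module ℂ (L₂ x)] [∀ x, TopologicalSpace (L₂ x)]
  [TopologicalSpace (TotalSpace ℂ L₂)] [FiberBundle ℂ L₂] [VectorBundle ℂ ℂ L₂]

variable (L₁ L₂) in
/-- A (not necessarily smooth) `(0,1)`-form with values in `L₁ ⊗ L₂^* = Hom(L₂, L₁)`: at each
point a conjugate-linear map from the tangent line to `Hom(L₂, L₁)`. -/
abbrev Form01Hom : Type _ :=
  ∀ x : M, TangentSpace 𝓘(ℂ) x →ₛₗ[starRingEnd ℂ] (L₂ x →ₗ[ℂ] L₁ x)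

/-- Smoothness of a `Hom(L₂, L₁)`-valued `(0,1)`-form: near each `x₀` its coefficient in the local
frames of `TM`, `L₂` and `L₁` around `x₀` is smooth. -/
def Form01Hom.IsSmooth [IsManifold 𝓘(ℂ) 1 M] (η : Form01Hom L₁ L₂) : Prop :=
  ∀ x₀ : M, SmoothSectionAt (L := L₁) (fun y =>
    η y ((trivializationAt ℂ (TangentSpace (M := M) 𝓘(ℂ)) x₀).symm y 1)
      ((trivializationAt ℂ L₂ x₀).symm y 1)) x₀

/-- The operator `D''_η = (D''₁, η; 0, D''₂)` on sections `ψ = (ψ₁, ψ₂)` of `E = L₁ ⊕ L₂`. -/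
def dbarExt (η : Form01Hom L₁ L₂) (ψ : ∀ x, L₁ x × L₂ x) (x : M) (v : TangentSpace 𝓘(ℂ) x) :
    L₁ x × L₂ x :=
  (dbarSection (fun y => (ψ y).1) x v + η x v (ψ x).2, dbarSection (fun y => (ψ y).2) x v)

/-- `ψ` is a smooth `D''_η`-holomorphic section of `E` in a neighbourhood of `x`. -/
def HolomorphicExtAt (η : Form01Hom L₁ L₂) (ψ : ∀ x, L₁ x × L₂ x) (x : M) : Prop :=
  ∀ᶠ y in 𝓝 x, SmoothSectionAt (fun t => (ψ t).1) y ∧ SmoothSectionAt (fun t => (ψ t).2) y ∧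
    ∀ v, dbarExt η ψ y v = 0

/-- A regular local section of `E` at `x`: holomorphic near `x`, and non-zero at `x`. -/
def RegularExtAt (η : Form01Hom L₁ L₂) (σ : ∀ x, L₁ x × L₂ x) (x : M) : Prop :=
  HolomorphicExtAt η σ x ∧ σ x ≠ 0

/-- `ψ` is a meromorphic section of `(E, D''_η)`: it is holomorphic off a finite set `P`, and near
each `x ∈ P` it is `c ^ m • σ`, where `c` is a local holomorphic coordinate vanishing at `x` and
`σ` is a regular holomorphic local section. (The values of `ψ` on `P` are irrelevant.) -/
def IsMeromorphicExtSection (η : Form01Hom L₁ L₂) (ψ : ∀ x, L₁ x × L₂ x) : Prop :=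
  ∃ P : Set M, P.Finite ∧ (∀ x ∉ P, HolomorphicExtAt η ψ x) ∧
    ∀ x ∈ P, ∃ (m : ℤ) (σ : ∀ x, L₁ x × L₂ x), RegularExtAt η σ x ∧
      ∀ᶠ y in 𝓝[≠] x, ψ y = (chartAt ℂ x y - chartAt ℂ x x) ^ m • σ y

/-- `J ⊆ E` is a holomorphic line subbundle of `(E, D''_η)`: near each point its fibres are the
lines spanned by a nowhere vanishing holomorphic local section of `E`. -/
def IsLineSubbundle (η : Form01Hom L₁ L₂) (J : ∀ x : M, Submodule ℂ (L₁ x × L₂ x)) : Prop :=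
  ∀ x : M, ∃ σ : ∀ x, L₁ x × L₂ x, HolomorphicExtAt η σ x ∧
    ∀ᶠ y in 𝓝 x, σ y ≠ 0 ∧ J y = Submodule.span ℂ {σ y}

/-- The meromorphic section `ψ` of `E` spans `J`: near each `x` one has `ψ = c ^ m • σ` off `x`,
with `c` a coordinate vanishing at `x` and `σ` a holomorphic section whose values span the fibres
of `J` near `x`, also at `x`. In particular `J x = ℂ ψ(x)` for all but finitely many `x`. -/
def SpansLineSubbundle (η : Form01Hom L₁ L₂) (ψ : ∀ x, L₁ x × L₂ x)
    (J : ∀ x : M, Submodule ℂ (L₁ x × L₂ x)) : Prop :=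
  ∀ x : M, ∃ (m : ℤ) (σ : ∀ x, L₁ x × L₂ x), HolomorphicExtAt η σ x ∧
    (∀ᶠ y in 𝓝 x, σ y ≠ 0 ∧ J y = Submodule.span ℂ {σ y}) ∧
    ∀ᶠ y in 𝓝[≠] x, ψ y = (chartAt ℂ x y - chartAt ℂ x x) ^ m • σ y

variable (L₁ L₂) in
/-- `L₁` as a subbundle of `E = L₁ ⊕ L₂`. -/
def firstSummand (x : M) : Submodule ℂ (L₁ x × L₂ x) := Submodule.prod ⊤ ⊥

end Extension

end Surface

/-- `ζ` is a canonical meromorphic section of the line bundle `L` on the sphere, and `deg L = d`: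
`ζ` is holomorphic without zeros on `S² ∖ {N}`, and near `N` it equals `w ^ d • e` with `e` a
regular holomorphic local section, so that the divisor of `ζ` is `d · N`. -/
structure IsCanonicalSection {L : RiemannSphere → Type*} [∀ x, AddCommGroup (L x)]
    [∀ x, Module ℂ (L x)] [∀ x, TopologicalSpace (L x)] [TopologicalSpace (TotalSpace ℂ L)]
    [FiberBundle ℂ L] (ζ : ∀ x, L x) (d : ℤ) : Prop where
  holomorphic : ∀ x ≠ OnePoint.infty, HolomorphicSectionAt ζ x
  ne_zero : ∀ x ≠ OnePoint.infty, ζ x ≠ 0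
  order_north : ∃ e : ∀ x, L x, HolomorphicSectionAt e OnePoint.infty ∧ e OnePoint.infty ≠ 0 ∧
    ∀ᶠ y in 𝓝[≠] (OnePoint.infty : RiemannSphere), ζ y = RiemannSphere.wChart y ^ d • e y

end

noncomputable section

set_option linter.unusedSectionVars false

/-! ## The operator `∂/∂z̄` on the plane -/

section Plane

open MeasureTheory Complex

/-! In the frames `ζ₁`, `ζ₂` and the coordinate `z`, `η` has a smooth coefficient `B` on `ℂ`, and
`(f ζ₁, ζ₂)` is holomorphic there exactly when `∂f/∂z̄ = -B`. The task is to solve this equation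
with control at `N`.

Existence. In regular frames near `N`, solve `∂g/∂w̄ = -K` for the coefficient `K` of `η`.
Multiplying the holomorphic section `(g e₁, e₂)` by `w ^ d₂` gives `(w ^ n g ζ₁, ζ₂)` with `n = d₂ -
d₁ ≥ 0`, so `w ^ n g` is a smooth local solution at `N`. Cut it off and correct the error, which has
compact support in `ℂ`, by its Cauchy transform (`exists_planarDbar_eq`). The correction is
holomorphic near `N` and tends to `0` there, hence extends holomorphically
(`exists_global_solution`). Extracting the right power of `w` shows that the result is meromorphic
at `N` (`exists_regular_representative`).

Line subbundles. A local generator of `J` has a holomorphic second component `S₂`, whose zeros are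
the points where `J = L₁`. By the identity theorem, connectedness and compactness these points are
finite in number when `J ≠ L₁`. Elsewhere off `N` the line `J y` contains exactly one vector with
second component `ζ₂ y`; its first component defines `h`. Both `f` and `f + h` solve the same
inhomogeneous `∂̄`-equation, so `h` is holomorphic away from finitely many points. Near such a point
a power of the coordinate times `h` is also continuous, so the singularity is at most a pole
(`meromorphicAt_of_planarHolomorphic`). The new section is a power of the coordinate times a
generator of `J`, which gives meromorphy and spanning together (`meromorphicAt_and_spans`). -/

/-- The Wirtinger derivative `∂u/∂z̄` of a function on the plane. -/
def planarDbar (u : ℂ → ℂ) (z : ℂ) : ℂ :=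
  (1 / 2 : ℂ) * (fderiv ℝ u z 1 + Complex.I * fderiv ℝ u z Complex.I)

theorem Filter.EventuallyEq.planarDbar_eq {u v : ℂ → ℂ} {z : ℂ} (h : u =ᶠ[𝓝 z] v) :
    planarDbar u z = planarDbar v z := by
  rw [planarDbar, planarDbar, h.fderiv_eq]

theorem planarDbar_add {u v : ℂ → ℂ} {z : ℂ} (hu : DifferentiableAt ℝ u z)
    (hv : DifferentiableAt ℝ v z) :
    planarDbar (fun t => u t + v t) z = planarDbar u z + planarDbar v z := by
  simp only [planarDbar, fderiv_fun_add hu hv, add_apply]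
  ring

theorem planarDbar_sub {u v : ℂ → ℂ} {z : ℂ} (hu : DifferentiableAt ℝ u z)
    (hv : DifferentiableAt ℝ v z) :
    planarDbar (fun t => u t - v t) z = planarDbar u z - planarDbar v z := by
  simp only [planarDbar, fderiv_fun_sub hu hv, sub_apply]
  ring

theorem planarDbar_mul {u v : ℂ → ℂ} {z : ℂ} (hu : DifferentiableAt ℝ u z)
    (hv : DifferentiableAt ℝ v z) :
    planarDbar (fun t => u t * v t) z = planarDbar u z * v z + u z * planarDbar v z := by
  simp only [planarDbar, fderiv_fun_mul hu hv, add_apply, smul_apply, smul_eq_mul]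
  ring

theorem DifferentiableAt.planarDbar_eq_zero {u : ℂ → ℂ} {z : ℂ} (hu : DifferentiableAt ℂ u z) :
    planarDbar u z = 0 := by
  have h := (differentiableAt_complex_iff_differentiableAt_real.1 hu).2
  rw [planarDbar, h, smul_eq_mul, ← mul_assoc, Complex.I_mul_I]
  ring

theorem planarDbar_const (a z : ℂ) : planarDbar (fun _ => a) z = 0 :=
  (differentiableAt_const a).planarDbar_eq_zero

theorem differentiableAt_of_planarDbar_eq_zero {u : ℂ → ℂ} {z : ℂ} (hu : DifferentiableAt ℝ u z)
    (h : planarDbar u z = 0) : DifferentiableAt ℂ u z := by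
  refine differentiableAt_complex_iff_differentiableAt_real.2 ⟨hu, ?_⟩
  rw [planarDbar] at h
  rw [smul_eq_mul]
  linear_combination (-2 * Complex.I) * h + fderiv ℝ u z Complex.I * Complex.I_mul_I

/-- A real linear endomorphism of `ℂ` in terms of its values on `1` and `I`. -/
theorem real_clm_apply (A : ℂ →L[ℝ] ℂ) (v : ℂ) : A v = v.re * A 1 + v.im * A Complex.I := by
  conv_lhs => rw [← Complex.re_add_im v]
  rw [map_add]
  have h1 : ((v.re : ℝ) : ℂ) = v.re • (1 : ℂ) := by simp
  have h2 : ((v.im : ℝ) : ℂ) * Complex.I = v.im • Complex.I := by simp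
  rw [h1, h2, map_smul, map_smul]
  simp

/-- The left side is the conjugate-linear part of `A` at `v`, so it is determined by its value at
`1`. -/
theorem half_add_I_mul_eq (A : ℂ →L[ℝ] ℂ) (v : ℂ) :
    (1 / 2 : ℂ) * (A v + Complex.I * A (Complex.I * v)) =
      (1 / 2 : ℂ) * (A 1 + Complex.I * A Complex.I) * starRingEnd ℂ v := by
  rw [real_clm_apply A v, real_clm_apply A (Complex.I * v)]
  have : starRingEnd ℂ v = v.re - v.im * Complex.I := by
    apply Complex.ext <;> simp
  rw [this]
  simp only [Complex.mul_re, Complex.I_re, zero_mul, Complex.I_im, one_mul, zero_sub,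
    Complex.mul_im, zero_add, Complex.ofReal_neg]
  linear_combination (v.im * A Complex.I / 2) * (Complex.I_mul_I)

theorem planarDbar_comp {u g : ℂ → ℂ} {z : ℂ} (hu : DifferentiableAt ℝ u (g z))
    (hg : DifferentiableAt ℂ g z) :
    planarDbar (fun t => u (g t)) z = planarDbar u (g z) * starRingEnd ℂ (deriv g z) := by
  have hg' := hg.hasDerivAt.hasFDerivAt.restrictScalars ℝ
  have h := (hu.hasFDerivAt.comp z hg').fderiv
  change fderiv ℝ (fun t => u (g t)) z = _ at h
  rw [planarDbar, h, planarDbar, ← half_add_I_mul_eq]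
  simp

theorem analyticAt_of_planarDbar_eq_zero {u : ℂ → ℂ} {z : ℂ}
    (h : ∀ᶠ w in 𝓝 z, DifferentiableAt ℝ u w ∧ planarDbar u w = 0) : AnalyticAt ℂ u z :=
  Complex.analyticAt_iff_eventually_differentiableAt.2
    (h.mono fun _ hw => differentiableAt_of_planarDbar_eq_zero hw.1 hw.2)

theorem _root_.AnalyticAt.contDiffAt_real {u : ℂ → ℂ} {z : ℂ} (h : AnalyticAt ℂ u z)
    {n : WithTop ℕ∞} : ContDiffAt ℝ n u z :=
  (h.contDiffAt (n := n)).restrict_scalars ℝ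

/-! ### The Cauchy transform -/

/-- In polar coordinates the Jacobian `r` cancels `|z|⁻¹`, leaving the area of a bounded rectangle.
-/
theorem locallyIntegrable_inv_complex : LocallyIntegrable (fun z : ℂ => z⁻¹) := by
  rw [locallyIntegrable_iff]
  intro K hK
  obtain ⟨R, hR⟩ := hK.isBounded.subset_closedBall 0
  refine IntegrableOn.mono_set ?_ hR
  have hm : Measurable fun z : ℂ => z⁻¹ := measurable_inv
  refine ⟨hm.aestronglyMeasurable, ?_⟩
  rw [HasFiniteIntegral, ← lintegral_indicator Metric.isClosed_closedBall.measurableSet,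
    ← Complex.lintegral_comp_polarCoord_symm]
  calc _ ≤ ∫⁻ p in polarCoord.target, (Set.Icc 0 R ×ˢ Set.Ioo (-Real.pi) Real.pi).indicator
        (fun _ => (1 : ENNReal)) p := by
        refine setLIntegral_mono' polarCoord.open_target.measurableSet fun p hp => ?_
        rw [polarCoord_target] at hp
        have hp1 : 0 < p.1 := hp.1
        by_cases h : Complex.polarCoord.symm p ∈ Metric.closedBall (0 : ℂ) R
        · have hR : p.1 ≤ R := by
            rw [mem_closedBall_zero_iff, Complex.norm_polarCoord_symm, abs_of_pos hp1] at h
            exact h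
          have hmem : p ∈ Set.Icc 0 R ×ˢ Set.Ioo (-Real.pi) Real.pi := ⟨⟨hp1.le, hR⟩, hp.2⟩
          have hne : Complex.polarCoord.symm p ≠ 0 := by
            rw [← norm_ne_zero_iff, Complex.norm_polarCoord_symm, abs_of_pos hp1]
            exact hp1.ne'
          rw [Set.indicator_of_mem h, Set.indicator_of_mem hmem, enorm_inv hne,
            ← ofReal_norm, Complex.norm_polarCoord_symm, abs_of_pos hp1, smul_eq_mul,
            ENNReal.mul_inv_cancel]
          · simpa using hp1
          · simp
        · rw [Set.indicator_of_notMem h]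
          simp
    _ ≤ ∫⁻ p, (Set.Icc 0 R ×ˢ Set.Ioo (-Real.pi) Real.pi).indicator
        (fun _ => (1 : ENNReal)) p := setLIntegral_le_lintegral _ _
    _ < ⊤ := by
        rw [lintegral_indicator (measurableSet_Icc.prod measurableSet_Ioo), setLIntegral_one,
          Measure.volume_eq_prod, Measure.prod_prod]
        simp [ENNReal.mul_lt_top]

/-- The Cauchy–Pompeiu formula at `0`. In polar coordinates the integrand is half of a radial
derivative plus `I` times an angular one. The radial part integrates to `-u 0` on each ray, and the
angular part vanishes on each circle by periodicity. -/
theorem integral_inv_mul_planarDbar {u : ℂ → ℂ} (hu : ContDiff ℝ 1 u) (hc : HasCompactSupport u) :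
    ∫ z, z⁻¹ * planarDbar u z = -Real.pi * u 0 := by
  let E : ℝ → ℂ := fun t => Real.cos t + Real.sin t * I
  have hEc : Continuous E := by fun_prop
  have hE' : ∀ t, HasDerivAt E (I * E t) t := by
    intro t
    have h := (((Real.hasDerivAt_cos t).ofReal_comp).add
      (((Real.hasDerivAt_sin t).ofReal_comp).mul_const I))
    refine h.congr_deriv ?_
    simp only [E, ofReal_neg]
    linear_combination -(Real.sin t : ℂ) * I_mul_I
  have hEne : ∀ t, E t * (Real.cos t - Real.sin t * I) = 1 := by
    intro t
    have : ((Real.cos t ^ 2 + Real.sin t ^ 2 : ℝ) : ℂ) = 1 := by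
      rw [Real.cos_sq_add_sin_sq, ofReal_one]
    push_cast at this
    simp only [E, ofReal_cos, ofReal_sin]
    linear_combination this - (Complex.sin t)^2 * I_mul_I
  have hEnorm : ∀ t, ‖E t‖ = 1 := by
    intro t
    have := Complex.norm_polarCoord_symm (1, t)
    simp only [Complex.polarCoord_symm_apply, abs_one, ofReal_one, one_mul] at this
    exact this
  have hu' : Continuous (fderiv ℝ u) := hu.continuous_fderiv one_ne_zero
  -- `Φ` is the radial derivative of `u`, and `Ψ` is `1 / r` times its angular derivative.
  let Φ : ℝ × ℝ → ℂ := fun p => fderiv ℝ u (p.1 * E p.2) (E p.2)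
  let Ψ : ℝ × ℝ → ℂ := fun p => fderiv ℝ u (p.1 * E p.2) (I * E p.2)
  have hΦc : Continuous Φ := by fun_prop
  have hΨc : Continuous Ψ := by fun_prop
  have hpol : ∀ p ∈ polarCoord.target, p.1 • ((Complex.polarCoord.symm p)⁻¹ *
      planarDbar u (Complex.polarCoord.symm p)) = (1 / 2 : ℂ) * (Φ p + I * Ψ p) := by
    intro p hp
    rw [polarCoord_target] at hp
    have hp1 : (p.1 : ℂ) ≠ 0 := by exact_mod_cast (ne_of_gt hp.1)
    have hs : Complex.polarCoord.symm p = p.1 * E p.2 := by simp [E]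
    rw [hs, half_add_I_mul_eq, planarDbar]
    have hconj : starRingEnd ℂ (E p.2) = Real.cos p.2 - Real.sin p.2 * I := by
      simp only [E, map_add, map_mul, conj_ofReal, conj_I]
      ring
    have hinv : (E p.2)⁻¹ = Real.cos p.2 - Real.sin p.2 * I :=
      inv_eq_of_mul_eq_one_right (hEne p.2)
    rw [hconj, mul_inv, hinv, real_smul]
    field_simp
  rw [← Complex.integral_comp_polarCoord_symm,
    setIntegral_congr_fun polarCoord.open_target.measurableSet hpol]
  obtain ⟨R, hR⟩ := hc.isCompact.isBounded.subset_closedBall 0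
  have hzero : ∀ r : ℝ, 0 < r → R < r → ∀ t v, fderiv ℝ u (r * E t) v = 0 := by
    intro r h0 hr t v
    have : (r * E t : ℂ) ∉ tsupport u := fun h => by
      have := hR h
      rw [mem_closedBall_zero_iff, norm_mul, hEnorm, mul_one, norm_real, Real.norm_eq_abs,
        abs_of_pos h0] at this
      linarith
    rw [fderiv_of_notMem_tsupport ℝ this]
    rfl
  have hint : ∀ F : ℝ × ℝ → ℂ, Continuous F → (∀ p : ℝ × ℝ, 0 < p.1 → R < p.1 → F p = 0) →
      IntegrableOn F (Set.Ioi (0 : ℝ) ×ˢ Set.Ioo (-Real.pi) Real.pi) := by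
    intro F hF h0
    have h1 : IntegrableOn F (Set.Icc (0 : ℝ) R ×ˢ Set.Icc (-Real.pi) Real.pi) :=
      hF.continuousOn.integrableOn_compact (isCompact_Icc.prod isCompact_Icc)
    refine h1.of_forall_sdiff_eq_zero (measurableSet_Ioi.prod measurableSet_Ioo) ?_
    rintro p ⟨⟨hp1, hp2⟩, hp⟩
    refine h0 p hp1 ?_
    by_contra hle
    exact hp ⟨⟨le_of_lt hp1, not_lt.1 hle⟩, Set.Ioo_subset_Icc_self hp2⟩
  have hΦi := hint Φ hΦc fun p h0 h => hzero _ h0 h _ _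
  have hΨi := hint Ψ hΨc fun p h0 h => hzero _ h0 h _ _
  have hu_diff : Differentiable ℝ u := hu.differentiable one_ne_zero
  have hI1 : ∫ p in Set.Ioi (0 : ℝ) ×ˢ Set.Ioo (-Real.pi) Real.pi, Φ p = -(2 * Real.pi) * u 0 := by
    have hinner : ∀ t : ℝ, ∫ r in Set.Ioi (0 : ℝ), Φ (r, t) = - u 0 := by
      intro t
      have hd : ∀ r : ℝ, HasDerivAt (fun r : ℝ => u (r * E t)) (Φ (r, t)) r := by
        intro r
        have h1 : HasDerivAt (fun r : ℝ => (r * E t : ℂ)) (E t) r := by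
          simpa using (ofRealCLM.hasDerivAt (x := r)).mul_const (E t)
        exact (hu_diff _).hasFDerivAt.comp_hasDerivAt r h1
      have hcs : HasCompactSupport (fun r : ℝ => u (r * E t)) := by
        refine HasCompactSupport.of_support_subset_isCompact (isCompact_Icc (a := -R) (b := R)) ?_
        intro r hr
        have := hR (subset_tsupport _ hr)
        rw [mem_closedBall_zero_iff, norm_mul, hEnorm, mul_one, norm_real, Real.norm_eq_abs] at this
        exact abs_le.1 this
      have hcd : ContDiff ℝ 1 (fun r : ℝ => u (r * E t)) :=
        hu.comp (ofRealCLM.contDiff.mul contDiff_const)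
      have := hcs.integral_Ioi_deriv_eq hcd 0
      rw [show deriv (fun r : ℝ => u (r * E t)) = fun r => Φ (r, t) from
        funext fun r => (hd r).deriv] at this
      simpa using this
    rw [Measure.volume_eq_prod] at hΦi ⊢
    rw [← setIntegral_prod_swap, setIntegral_prod]
    · simp only [Prod.swap, hinner]
      rw [setIntegral_const, Measure.real, Real.volume_Ioo,
        ENNReal.toReal_ofReal (by linarith [Real.pi_pos]), real_smul]
      push_cast
      ring
    · exact hΦi.swap
  have hI2 : ∫ p in Set.Ioi (0 : ℝ) ×ˢ Set.Ioo (-Real.pi) Real.pi, Ψ p = 0 := by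
    rw [Measure.volume_eq_prod] at hΨi ⊢
    rw [setIntegral_prod _ hΨi]
    refine setIntegral_eq_zero_of_forall_eq_zero fun r hr => ?_
    have hr : (0 : ℝ) < r := hr
    have hd : ∀ t : ℝ, HasDerivAt (fun t : ℝ => u (r * E t)) (r * Ψ (r, t)) t := by
      intro t
      have h1 : HasDerivAt (fun t : ℝ => (r * E t : ℂ)) (r * (I * E t)) t := (hE' t).const_mul _
      have := (hu_diff _).hasFDerivAt.comp_hasDerivAt t h1
      refine this.congr_deriv ?_
      change _ = (r : ℂ) * fderiv ℝ u (r * E t) (I * E t)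
      rw [← real_smul (x := r) (z := I * E t), map_smul, real_smul]
    have hval : ∫ t in (-Real.pi)..Real.pi, (r : ℂ) * Ψ (r, t) = 0 := by
      rw [intervalIntegral.integral_eq_sub_of_hasDerivAt (fun t _ => hd t)
        (Continuous.intervalIntegrable (by fun_prop) _ _)]
      simp [E]
    rw [intervalIntegral.integral_of_le (by linarith [Real.pi_pos]), integral_Ioc_eq_integral_Ioo,
      integral_const_mul] at hval
    exact (mul_eq_zero.1 hval).resolve_left (by exact_mod_cast hr.ne')
  rw [polarCoord_target, integral_const_mul, integral_add hΦi (hΨi.const_mul _),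
    integral_const_mul, hI1, hI2]
  ring

/-- Solution of `∂k/∂z̄ = b` on the plane by the Cauchy transform, when `b` is smooth with compact
support. -/
theorem exists_planarDbar_eq {b : ℂ → ℂ} (hb : ContDiff ℝ ∞ b) (hc : HasCompactSupport b) :
    ∃ k : ℂ → ℂ, ContDiff ℝ ∞ k ∧ (∀ z, planarDbar k z = b z) ∧
      Tendsto k (Bornology.cobounded ℂ) (𝓝 0) := by
  -- The fundamental solution of `∂/∂z̄`.
  let K : ℂ → ℂ := fun z => (Real.pi : ℂ)⁻¹ * z⁻¹
  have hK : LocallyIntegrable K := locallyIntegrable_inv_complex.smul (Real.pi : ℂ)⁻¹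
  let L := ContinuousLinearMap.mul ℝ ℂ
  refine ⟨MeasureTheory.convolution K b L volume, hc.contDiff_convolution_right L hK hb, ?_, ?_⟩
  · intro z
    have hb1 : ContDiff ℝ 1 b := hb.of_le (by exact_mod_cast le_top)
    have hd := (hc.hasFDerivAt_convolution_right L hK hb1 z).fderiv
    have hex : ConvolutionExistsAt K (fderiv ℝ b) z (L.precompR ℂ) :=
      (hc.fderiv ℝ).convolutionExists_right _ hK (hb1.continuous_fderiv one_ne_zero) z
    have happ : ∀ v, (MeasureTheory.convolution K (fderiv ℝ b) (L.precompR ℂ) volume z) v =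
        ∫ t, K t * fderiv ℝ b (z - t) v := by
      intro v
      rw [MeasureTheory.convolution, ContinuousLinearMap.integral_apply hex]
      rfl
    have hint : ∀ v, Integrable fun t => K t * fderiv ℝ b (z - t) v := fun v =>
      (ContinuousLinearMap.apply ℝ ℂ v).integrable_comp hex
    rw [planarDbar, hd, happ, happ, ← integral_const_mul, ← integral_add (hint 1)
      ((hint I).const_mul I), ← integral_const_mul]
    have hu : ContDiff ℝ 1 (fun t => b (z - t)) := hb1.comp (contDiff_const.sub contDiff_id)
    have hcu : HasCompactSupport (fun t => b (z - t)) :=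
      hc.comp_homeomorph (Homeomorph.subLeft z)
    have hfd : ∀ t v, fderiv ℝ (fun t => b (z - t)) t v = - fderiv ℝ b (z - t) v := by
      intro t v
      have h1 : HasFDerivAt (fun t : ℂ => z - t) (-ContinuousLinearMap.id ℝ ℂ) t :=
        (hasFDerivAt_id t).const_sub z
      have := ((hb1.differentiable one_ne_zero (z - t)).hasFDerivAt.comp t h1).fderiv
      change fderiv ℝ (fun t => b (z - t)) t = _ at this
      rw [this]
      simp
    -- Reflecting and translating `b` moves the pole to the origin, where the integrand takes the
    -- value `b z`. The sign of the reflection cancels that of `-π`.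
    have key := integral_inv_mul_planarDbar hu hcu
    have heq : (fun t => (1 / 2 : ℂ) * (K t * fderiv ℝ b (z - t) 1 +
        I * (K t * fderiv ℝ b (z - t) I))) =
        fun t => -(Real.pi : ℂ)⁻¹ * (t⁻¹ * planarDbar (fun t => b (z - t)) t) := by
      funext t
      simp only [planarDbar, hfd, K]
      ring
    rw [heq, integral_const_mul, key, sub_zero]
    have : (Real.pi : ℂ) ≠ 0 := by exact_mod_cast Real.pi_ne_zero
    field_simp
  · obtain ⟨R, hR⟩ := hc.isCompact.isBounded.subset_closedBall 0
    have hbound : ∀ z : ℂ, R < ‖z‖ → ‖MeasureTheory.convolution K b L volume z‖ ≤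
        (Real.pi⁻¹ * ∫ t, ‖b t‖) * (‖z‖ - R)⁻¹ := by
      intro z hz
      -- After the flip the kernel is evaluated at `z - t` with `t` in the support of `b`, at
      -- distance at least `‖z‖ - R` from `0`.
      rw [← convolution_flip, MeasureTheory.convolution]
      have hbi : Integrable (fun t => ‖b t‖) := (hb.continuous.integrable_of_hasCompactSupport hc).norm
      calc _ ≤ ∫ t, Real.pi⁻¹ * (‖z‖ - R)⁻¹ * ‖b t‖ := by
            refine norm_integral_le_of_norm_le (hbi.const_mul _) (Eventually.of_forall fun t => ?_)
            by_cases ht : t ∈ tsupport b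
            · have htR : ‖t‖ ≤ R := mem_closedBall_zero_iff.1 (hR ht)
              have h1 : ‖z‖ - R ≤ ‖z - t‖ := by linarith [norm_sub_norm_le z t]
              have h2 : ‖z - t‖⁻¹ ≤ (‖z‖ - R)⁻¹ := inv_anti₀ (by linarith) h1
              simp only [L, K, ContinuousLinearMap.flip_apply, ContinuousLinearMap.mul_apply',
                norm_mul, norm_inv, norm_real, Real.norm_eq_abs, abs_of_pos Real.pi_pos]
              gcongr
            · simp [image_eq_zero_of_notMem_tsupport ht]
        _ = _ := by
            rw [integral_const_mul]
            ring
    have hlim : Tendsto (fun z : ℂ => (Real.pi⁻¹ * ∫ t, ‖b t‖) * (‖z‖ - R)⁻¹)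
        (Bornology.cobounded ℂ) (𝓝 0) := by
      rw [← mul_zero (Real.pi⁻¹ * ∫ t, ‖b t‖)]
      refine Tendsto.const_mul _ (tendsto_inv_atTop_zero.comp ?_)
      exact tendsto_atTop_add_const_right _ _ tendsto_norm_cobounded_atTop
    refine squeeze_zero_norm' ?_ hlim
    filter_upwards [tendsto_norm_cobounded_atTop.eventually (eventually_gt_atTop R)] with z hz
      using hbound z hz

end Plane

section Charts

variable {M : Type*} [TopologicalSpace M] [ChartedSpace ℂ M]

/-! ### Functions on a Riemann surface in a chart -/

theorem contMDiffAt_iff_contDiffAt_chart {𝕜 : Type*} [NontriviallyNormedField 𝕜] [NormedSpace 𝕜 ℂ]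
    {n : WithTop ℕ∞} {u : M → ℂ} {x : M} :
    ContMDiffAt 𝓘(𝕜, ℂ) 𝓘(𝕜, ℂ) n u x ↔
      ContDiffAt 𝕜 n (u ∘ (chartAt ℂ x).symm) (chartAt ℂ x x) := by
  rw [contMDiffAt_iff]
  simp only [mfld_simps, contDiffWithinAt_univ]
  refine ⟨fun h => h.2, fun h => ⟨?_, h⟩⟩
  have h1 := h.continuousAt.comp ((chartAt ℂ x).continuousAt (mem_chart_source ℂ x))
  refine h1.congr ?_
  filter_upwards [(chartAt ℂ x).open_source.mem_nhds (mem_chart_source ℂ x)] with y hy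
  simp [(chartAt ℂ x).left_inv hy]

theorem ContMDiffAt.contMDiffAt_real {u : M → ℂ} {x : M} (h : ContMDiffAt 𝓘(ℂ) 𝓘(ℂ) ω u x) :
    ContMDiffAt 𝓘(ℝ, ℂ) 𝓘(ℝ, ℂ) ∞ u x := by
  rw [contMDiffAt_iff_contDiffAt_chart] at h ⊢
  exact (h.restrict_scalars ℝ).of_le le_top

theorem ContMDiffAt.differentiableAt_chart {u : M → ℂ} {x : M}
    (h : ContMDiffAt 𝓘(ℝ, ℂ) 𝓘(ℝ, ℂ) ∞ u x) :
    DifferentiableAt ℝ (u ∘ (chartAt ℂ x).symm) (chartAt ℂ x x) :=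
  (contMDiffAt_iff_contDiffAt_chart.1 h).differentiableAt (by simp)

theorem dbar_eq_planarDbar {u : M → ℂ} {x : M} (hu : ContMDiffAt 𝓘(ℝ, ℂ) 𝓘(ℝ, ℂ) ∞ u x)
    (v : ℂ) :
    dbar u x v = planarDbar (u ∘ (chartAt ℂ x).symm) (chartAt ℂ x x) * starRingEnd ℂ v := by
  have h : mfderiv 𝓘(ℝ, ℂ) 𝓘(ℝ, ℂ) u x =
      fderiv ℝ (u ∘ (chartAt ℂ x).symm) (chartAt ℂ x x) := by
    rw [(hu.mdifferentiableAt (by simp)).mfderiv]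
    simp only [mfld_simps, fderivWithin_univ, writtenInExtChartAt]
    rfl
  have h2 : ∀ t : ℂ, (mfderiv 𝓘(ℝ, ℂ) 𝓘(ℝ, ℂ) u x t : ℂ) =
      fderiv ℝ (u ∘ (chartAt ℂ x).symm) (chartAt ℂ x x) t := fun t => by rw [h]; rfl
  rw [planarDbar, ← half_add_I_mul_eq, ← h2, ← h2]
  rfl

theorem Filter.EventuallyEq.dbar_eq {u v : M → ℂ} {x : M} (h : u =ᶠ[𝓝 x] v) (w : ℂ) :
    dbar u x w = dbar v x w := by
  have h2 : ∀ t : ℂ, (mfderiv 𝓘(ℝ, ℂ) 𝓘(ℝ, ℂ) u x t : ℂ) =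
      (mfderiv 𝓘(ℝ, ℂ) 𝓘(ℝ, ℂ) v x t : ℂ) := fun t => by
    rw [h.mfderiv_eq]
    rfl
  exact congrArg (fun du : ℂ → ℂ => (1 / 2 : ℂ) * (du w + Complex.I * du (Complex.I * w)))
    (funext h2)

theorem dbar_mul_holomorphic {u g : M → ℂ} {x : M} (hu : ContMDiffAt 𝓘(ℝ, ℂ) 𝓘(ℝ, ℂ) ∞ u x)
    (hg : ContMDiffAt 𝓘(ℂ) 𝓘(ℂ) ω g x) (v : ℂ) :
    dbar (fun y => u y * g y) x v = dbar u x v * g x := by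
  have hg' := hg.contMDiffAt_real
  have hug : ContMDiffAt 𝓘(ℝ, ℂ) 𝓘(ℝ, ℂ) ∞ (fun y => u y * g y) x := by
    rw [contMDiffAt_iff_contDiffAt_chart] at hu hg' ⊢
    exact hu.mul hg'
  rw [dbar_eq_planarDbar hug, dbar_eq_planarDbar hu]
  have h0 : planarDbar (g ∘ (chartAt ℂ x).symm) (chartAt ℂ x x) = 0 :=
    ((contMDiffAt_iff_contDiffAt_chart.1 hg).differentiableAt (by simp)).planarDbar_eq_zero
  have := planarDbar_mul hu.differentiableAt_chart hg'.differentiableAt_chart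
  rw [h0, mul_zero, add_zero] at this
  change planarDbar (fun t => (u ∘ (chartAt ℂ x).symm) t * (g ∘ (chartAt ℂ x).symm) t) _ * _ = _
  rw [this, Function.comp_apply (f := g), (chartAt ℂ x).left_inv (mem_chart_source ℂ x)]
  ring

theorem tendsto_chart_symm {x y : M} (hy : y ∈ (chartAt ℂ x).source) :
    Tendsto (chartAt ℂ x).symm (𝓝 (chartAt ℂ x y)) (𝓝 y) := by
  have := ((chartAt ℂ x).symm.continuousAt ((chartAt ℂ x).map_source hy)).tendsto
  rwa [(chartAt ℂ x).left_inv hy] at this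

variable [IsManifold 𝓘(ℂ) ω M]

theorem analyticAt_chart_transition {x y z : M} (hx : z ∈ (chartAt ℂ x).source)
    (hy : z ∈ (chartAt ℂ y).source) :
    AnalyticAt ℂ (chartAt ℂ y ∘ (chartAt ℂ x).symm) (chartAt ℂ x z) := by
  have := contDiffWithinAt_ext_coord_change (I := 𝓘(ℂ)) (n := ω) y x (y := chartAt ℂ x z)
    (by simp [hx, hy])
  simp only [mfld_simps, contDiffWithinAt_univ] at this
  exact this.analyticAt

/-- Smoothness at `y` is defined through the chart at `y`. Transitions are analytic, so the single
chart at `x` serves for all nearby points. -/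
theorem contMDiffAt_comp_chart_iff {u : ℂ → ℂ} {x y : M} (hy : y ∈ (chartAt ℂ x).source) :
    ContMDiffAt 𝓘(ℝ, ℂ) 𝓘(ℝ, ℂ) ∞ (fun t => u (chartAt ℂ x t)) y ↔
      ContDiffAt ℝ ∞ u (chartAt ℂ x y) := by
  rw [contMDiffAt_iff_contDiffAt_chart]
  have hyy := mem_chart_source ℂ y
  have h1 := (analyticAt_chart_transition hyy hy).contDiffAt_real (n := ∞)
  have h2 := (analyticAt_chart_transition hy hyy).contDiffAt_real (n := ∞)
  constructor
  · intro h
    have h3 : (chartAt ℂ y ∘ (chartAt ℂ x).symm) (chartAt ℂ x y) = chartAt ℂ y y := by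
      simp [(chartAt ℂ x).left_inv hy]
    refine (ContDiffAt.comp _ (h3 ▸ h) h2).congr_of_eventuallyEq ?_
    filter_upwards [(tendsto_chart_symm hy).eventually ((chartAt ℂ y).open_source.mem_nhds hyy),
      (chartAt ℂ x).open_target.mem_nhds ((chartAt ℂ x).map_source hy)] with t ht ht'
    simp [(chartAt ℂ y).left_inv ht, (chartAt ℂ x).right_inv ht']
  · intro h
    have h3 : (chartAt ℂ x ∘ (chartAt ℂ y).symm) (chartAt ℂ y y) = chartAt ℂ x y := by
      simp
    have h4 := ContDiffAt.comp (g := u) (chartAt ℂ y y) (by rwa [h3]) h1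
    exact h4

/-- The coordinate vector field of the chart at `x`. -/
def coordVector [IsManifold 𝓘(ℂ) 1 M] (x y : M) : ℂ :=
  (trivializationAt ℂ (TangentSpace (M := M) 𝓘(ℂ)) x).symm y 1

theorem coordVector_eq_deriv [IsManifold 𝓘(ℂ) 1 M] {x y : M} (hy : y ∈ (chartAt ℂ x).source) :
    coordVector x y = deriv (chartAt ℂ y ∘ (chartAt ℂ x).symm) (chartAt ℂ x y) := by
  have h1 : coordVector x y =
      (trivializationAt ℂ (TangentSpace (M := M) 𝓘(ℂ)) x).symmL ℂ y 1 := by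
    exact ((trivializationAt ℂ (TangentSpace (M := M) 𝓘(ℂ)) x).symmL_apply hy 1).symm
  rw [h1, TangentBundle.symmL_trivializationAt_eq_core hy, tangentBundleCore_coordChange_achart]
  simp only [mfld_simps, fderivWithin_univ]
  rfl

/-- The tangent space at `y` is read in the chart at `y`, so the two factors are derivatives of
mutually inverse transition maps. -/
theorem deriv_transition_mul_coordVector [IsManifold 𝓘(ℂ) 1 M] {x y : M} (hy : y ∈ (chartAt ℂ x).source) :
    deriv (chartAt ℂ x ∘ (chartAt ℂ y).symm) (chartAt ℂ y y) * coordVector x y = 1 := by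
  have hyy := mem_chart_source ℂ y
  rw [coordVector_eq_deriv hy]
  have h1 := (analyticAt_chart_transition hyy hy).differentiableAt
  have h2 := (analyticAt_chart_transition hy hyy).differentiableAt
  have h3 : (chartAt ℂ y ∘ (chartAt ℂ x).symm) (chartAt ℂ x y) = chartAt ℂ y y := by
    simp [(chartAt ℂ x).left_inv hy]
  have h4 := deriv_comp (chartAt ℂ x y) (h₂ := chartAt ℂ x ∘ (chartAt ℂ y).symm) (by rwa [h3]) h2
  rw [h3] at h4
  rw [← h4]
  have : (chartAt ℂ x ∘ (chartAt ℂ y).symm) ∘ (chartAt ℂ y ∘ (chartAt ℂ x).symm)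
      =ᶠ[𝓝 (chartAt ℂ x y)] id := by
    filter_upwards [(tendsto_chart_symm hy).eventually ((chartAt ℂ y).open_source.mem_nhds hyy),
      (chartAt ℂ x).open_target.mem_nhds ((chartAt ℂ x).map_source hy)] with t ht ht'
    simp [(chartAt ℂ y).left_inv ht, (chartAt ℂ x).right_inv ht']
  rw [this.deriv_eq, deriv_id]

theorem dbar_comp_chart {u : ℂ → ℂ} {x y : M} (hy : y ∈ (chartAt ℂ x).source)
    (hu : ContDiffAt ℝ ∞ u (chartAt ℂ x y)) (v : ℂ) :
    dbar (fun t => u (chartAt ℂ x t)) y v = planarDbar u (chartAt ℂ x y) *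
      starRingEnd ℂ (deriv (chartAt ℂ x ∘ (chartAt ℂ y).symm) (chartAt ℂ y y) * v) := by
  rw [dbar_eq_planarDbar ((contMDiffAt_comp_chart_iff hy).2 hu)]
  have h3 : (chartAt ℂ x ∘ (chartAt ℂ y).symm) (chartAt ℂ y y) = chartAt ℂ x y := by simp
  have := planarDbar_comp (u := u) (g := chartAt ℂ x ∘ (chartAt ℂ y).symm) (z := chartAt ℂ y y)
    (by rw [h3]; exact hu.differentiableAt (by simp))
    (analyticAt_chart_transition (mem_chart_source ℂ y) hy).differentiableAt
  rw [h3] at this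
  rw [map_mul, ← mul_assoc, ← this]
  rfl

end Charts

section LineBundle

variable {M : Type*} [TopologicalSpace M] [ChartedSpace ℂ M]
  {L : M → Type*} [∀ x, AddCommGroup (L x)] [∀ x, Module ℂ (L x)]
  [∀ x, TopologicalSpace (L x)] [TopologicalSpace (TotalSpace ℂ L)] [FiberBundle ℂ L]

/-! ### Sections of a line bundle in a holomorphic frame -/

theorem HolomorphicSectionAt.contMDiffAt {e : ∀ x, L x} {x : M} (he : HolomorphicSectionAt e x) :
    ContMDiffAt 𝓘(ℂ) 𝓘(ℂ) ω (fun y => (trivializationAt ℂ L x ⟨y, e y⟩).2) x :=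
  (contMDiffAt_section x).1 he

variable [VectorBundle ℂ ℂ L]

theorem trivializationAt_smul {x y : M} (hy : y ∈ (trivializationAt ℂ L x).baseSet) (c : ℂ)
    (s : L y) : (trivializationAt ℂ L x ⟨y, c • s⟩).2 = c * (trivializationAt ℂ L x ⟨y, s⟩).2 :=
  ((trivializationAt ℂ L x).linear ℂ hy).map_smul c s

theorem trivializationAt_injective {x y : M} (hy : y ∈ (trivializationAt ℂ L x).baseSet)
    {s s' : L y} (h : (trivializationAt ℂ L x ⟨y, s⟩).2 = (trivializationAt ℂ L x ⟨y, s'⟩).2) :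
    s = s' :=
  ((trivializationAt ℂ L x).continuousLinearEquivAt ℂ y hy).injective h

theorem trivializationAt_ne_zero {x y : M} (hy : y ∈ (trivializationAt ℂ L x).baseSet)
    {s : L y} (h : s ≠ 0) : (trivializationAt ℂ L x ⟨y, s⟩).2 ≠ 0 := fun h0 =>
  h (trivializationAt_injective hy (h0.trans
    (((trivializationAt ℂ L x).linear ℂ hy).map_zero).symm))

theorem exists_eq_smul_of_ne_zero {y : M} {e : L y} (he : e ≠ 0) (s : L y) :
    ∃ c : ℂ, s = c • e := by
  have hy := mem_baseSet_trivializationAt ℂ L y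
  refine ⟨(trivializationAt ℂ L y ⟨y, s⟩).2 / (trivializationAt ℂ L y ⟨y, e⟩).2,
    trivializationAt_injective hy ?_⟩
  rw [trivializationAt_smul hy, div_mul_cancel₀ _ (trivializationAt_ne_zero hy he)]

theorem eventually_mem_baseSet_trivializationAt (x : M) :
    ∀ᶠ y in 𝓝 x, y ∈ (trivializationAt ℂ L x).baseSet :=
  (trivializationAt ℂ L x).open_baseSet.mem_nhds (mem_baseSet_trivializationAt ℂ L x)

theorem HolomorphicSectionAt.eventually_ne_zero {e : ∀ x, L x} {x : M}
    (he : HolomorphicSectionAt e x) (h0 : e x ≠ 0) : ∀ᶠ y in 𝓝 x, e y ≠ 0 := by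
  filter_upwards [he.contMDiffAt.continuousAt.eventually_ne
    (trivializationAt_ne_zero (mem_baseSet_trivializationAt ℂ L x) h0),
    eventually_mem_baseSet_trivializationAt (L := L) x] with y hy hb h
  rw [h] at hy
  exact hy ((trivializationAt ℂ L x).linear ℂ hb).map_zero

/-- Two holomorphic sections differ by a holomorphic factor where the second one has no zero. -/
theorem HolomorphicSectionAt.exists_eq_smul {e e' : ∀ x, L x} {x : M}
    (he' : HolomorphicSectionAt e' x) (he : HolomorphicSectionAt e x) (h0 : e x ≠ 0) :
    ∃ r : M → ℂ, ContMDiffAt 𝓘(ℂ) 𝓘(ℂ) ω r x ∧ ∀ᶠ y in 𝓝 x, e' y = r y • e y := by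
  refine ⟨fun y => (trivializationAt ℂ L x ⟨y, e' y⟩).2 / (trivializationAt ℂ L x ⟨y, e y⟩).2,
    ?_, ?_⟩
  · have h1 := contMDiffAt_iff_contDiffAt_chart.1 he'.contMDiffAt
    have h2 := contMDiffAt_iff_contDiffAt_chart.1 he.contMDiffAt
    refine contMDiffAt_iff_contDiffAt_chart.2 (h1.fun_div h2 ?_)
    change (fun y => (trivializationAt ℂ L x ⟨y, e y⟩).2) _ ≠ 0
    rw [(chartAt ℂ x).left_inv (mem_chart_source ℂ x)]
    exact trivializationAt_ne_zero (mem_baseSet_trivializationAt ℂ L x) h0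
  · filter_upwards [he.eventually_ne_zero h0,
      eventually_mem_baseSet_trivializationAt (L := L) x] with y hy hb
    refine trivializationAt_injective hb ?_
    rw [trivializationAt_smul hb, div_mul_cancel₀ _ (trivializationAt_ne_zero hb hy)]

theorem smoothSectionAt_smul_iff {e s : ∀ x, L x} {u : M → ℂ} {x : M}
    (he : HolomorphicSectionAt e x) (h0 : e x ≠ 0) (hs : ∀ᶠ y in 𝓝 x, s y = u y • e y) :
    SmoothSectionAt s x ↔ ContMDiffAt 𝓘(ℝ, ℂ) 𝓘(ℝ, ℂ) ∞ u x := by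
  have hg := contMDiffAt_iff_contDiffAt_chart.1 he.contMDiffAt.contMDiffAt_real
  have heq : ∀ᶠ y in 𝓝 x, (trivializationAt ℂ L x ⟨y, s y⟩).2 =
      u y * (trivializationAt ℂ L x ⟨y, e y⟩).2 := by
    filter_upwards [hs, eventually_mem_baseSet_trivializationAt (L := L) x] with y hy hb
    rw [hy, trivializationAt_smul hb]
  have hne : ∀ᶠ y in 𝓝 x, (trivializationAt ℂ L x ⟨y, e y⟩).2 ≠ 0 := by
    filter_upwards [he.eventually_ne_zero h0,
      eventually_mem_baseSet_trivializationAt (L := L) x] with y hy hb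
    exact trivializationAt_ne_zero hb hy
  rw [SmoothSectionAt, contMDiffAt_section x]
  constructor
  · intro h
    have h1 := contMDiffAt_iff_contDiffAt_chart.1 h
    have h2 : ContMDiffAt 𝓘(ℝ, ℂ) 𝓘(ℝ, ℂ) ∞ (fun y => (trivializationAt ℂ L x ⟨y, s y⟩).2 *
        ((trivializationAt ℂ L x ⟨y, e y⟩).2)⁻¹) x := by
      refine contMDiffAt_iff_contDiffAt_chart.2 (h1.mul (hg.inv ?_))
      rw [Function.comp_apply, (chartAt ℂ x).left_inv (mem_chart_source ℂ x)]
      exact hne.self_of_nhds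
    refine h2.congr_of_eventuallyEq ?_
    filter_upwards [heq, hne] with y hy hy0
    rw [hy, mul_inv_cancel_right₀ hy0]
  · intro h
    have h1 := contMDiffAt_iff_contDiffAt_chart.1 h
    have h2 : ContMDiffAt 𝓘(ℝ, ℂ) 𝓘(ℝ, ℂ) ∞
        (fun y => u y * (trivializationAt ℂ L x ⟨y, e y⟩).2) x :=
      contMDiffAt_iff_contDiffAt_chart.2 (h1.mul hg)
    exact h2.congr_of_eventuallyEq heq

/-- A holomorphic frame is a holomorphic factor in the trivialization, so Leibniz leaves only `∂̄`
of the coefficient: the operator may be computed in any holomorphic frame. -/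
theorem dbarSection_smul {e s : ∀ x, L x} {u : M → ℂ} {x : M}
    (he : HolomorphicSectionAt e x) (hu : ContMDiffAt 𝓘(ℝ, ℂ) 𝓘(ℝ, ℂ) ∞ u x)
    (hs : ∀ᶠ y in 𝓝 x, s y = u y • e y) (v : TangentSpace 𝓘(ℂ) x) :
    dbarSection s x v = dbar u x v • e x := by
  have heq : (fun y => (trivializationAt ℂ L x ⟨y, s y⟩).2) =ᶠ[𝓝 x]
      fun y => u y * (trivializationAt ℂ L x ⟨y, e y⟩).2 := by
    filter_upwards [hs, eventually_mem_baseSet_trivializationAt (L := L) x] with y hy hb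
    rw [hy, trivializationAt_smul hb]
  have hx := mem_baseSet_trivializationAt ℂ L x
  have h1 : dbar (fun y => (trivializationAt ℂ L x ⟨y, s y⟩).2) x v =
      dbar u x v * (trivializationAt ℂ L x ⟨x, e x⟩).2 :=
    (heq.dbar_eq v).trans (dbar_mul_holomorphic hu he.contMDiffAt v)
  rw [dbarSection, h1]
  refine trivializationAt_injective hx ?_
  rw [trivializationAt_smul hx, Trivialization.apply_mk_symm _ hx]

/-- Read in the trivialization at `y`, the section is a holomorphic coordinate change applied to
`1`. -/
theorem holomorphicSectionAt_trivialization_symm [ContMDiffVectorBundle ω ℂ L 𝓘(ℂ)] {x y : M}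
    (hy : y ∈ (trivializationAt ℂ L x).baseSet) :
    HolomorphicSectionAt (fun t => (trivializationAt ℂ L x).symm t (1 : ℂ)) y := by
  refine (contMDiffAt_section y).2 ?_
  have hyy := mem_baseSet_trivializationAt ℂ L y
  have h := contMDiffAt_coordChangeL (IB := 𝓘(ℂ)) (n := ω) (e := trivializationAt ℂ L x)
    (e' := trivializationAt ℂ L y) hy hyy
  have h2 : ContMDiffAt 𝓘(ℂ) 𝓘(ℂ) ω (fun t => ((trivializationAt ℂ L x).coordChangeL ℂ
      (trivializationAt ℂ L y) t : ℂ →L[ℂ] ℂ) 1) y := h.clm_apply contMDiffAt_const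
  refine h2.congr_of_eventuallyEq ?_
  filter_upwards [(trivializationAt ℂ L x).open_baseSet.mem_nhds hy,
    (trivializationAt ℂ L y).open_baseSet.mem_nhds hyy] with t ht ht'
  exact ((trivializationAt ℂ L x).coordChangeL_apply _ ⟨ht, ht'⟩ 1).symm

theorem trivialization_symm_one_ne_zero {x y : M}
    (hy : y ∈ (trivializationAt ℂ L x).baseSet) :
    (trivializationAt ℂ L x).symm y (1 : ℂ) ≠ 0 := by
  intro h
  have h1 := (trivializationAt ℂ L x).apply_mk_symm hy (1 : ℂ)
  rw [h] at h1
  have := ((trivializationAt ℂ L x).linear ℂ hy).map_zero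
  rw [h1] at this
  exact one_ne_zero this

end LineBundle

section Extension

variable {M : Type*} [TopologicalSpace M] [ChartedSpace ℂ M] [IsManifold 𝓘(ℂ) ω M]
  [IsManifold 𝓘(ℂ) 1 M]

/-! ### The extension in local holomorphic frames -/

theorem holomorphicSectionAt_coordVector {x y : M} (hy : y ∈ (chartAt ℂ x).source) :
    HolomorphicSectionAt (L := fun z : M => TangentSpace 𝓘(ℂ) z) (fun t => coordVector x t) y := by
  have : IsManifold 𝓘(ℂ) (ω + 1) M := ‹IsManifold 𝓘(ℂ) ω M›
  have : ContMDiffVectorBundle ω ℂ (TangentSpace 𝓘(ℂ) : M → Type _) 𝓘(ℂ) :=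
    TangentBundle.contMDiffVectorBundle
  exact holomorphicSectionAt_trivialization_symm (L := (TangentSpace 𝓘(ℂ) : M → Type _)) (x := x)
    (y := y) hy

theorem coordVector_ne_zero {x y : M} (hy : y ∈ (chartAt ℂ x).source) : coordVector x y ≠ 0 :=
  right_ne_zero_of_mul (deriv_transition_mul_coordVector hy ▸ one_ne_zero)

variable {L₁ L₂ : M → Type*}
  [∀ x, AddCommGroup (L₁ x)] [∀ x, Module ℂ (L₁ x)] [∀ x, TopologicalSpace (L₁ x)]
  [TopologicalSpace (TotalSpace ℂ L₁)] [FiberBundle ℂ L₁] [VectorBundle ℂ ℂ L₁]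
  [∀ x, AddCommGroup (L₂ x)] [∀ x, Module ℂ (L₂ x)] [∀ x, TopologicalSpace (L₂ x)]
  [TopologicalSpace (TotalSpace ℂ L₂)] [FiberBundle ℂ L₂] [VectorBundle ℂ ℂ L₂]
  {η : Form01Hom L₁ L₂}

theorem HolomorphicSectionAt.exists_coefficient {e : ∀ x, L₁ x} {x : M}
    (he : HolomorphicSectionAt e x) (h0 : e x ≠ 0) (s : ∀ x, L₁ x) :
    ∃ u : M → ℂ, ∀ᶠ y in 𝓝 x, s y = u y • e y := by
  have : ∀ y, ∃ c : ℂ, e y ≠ 0 → s y = c • e y := fun y => by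
    by_cases h : e y = 0
    · exact ⟨0, fun h' => absurd h h'⟩
    · obtain ⟨c, hc⟩ := exists_eq_smul_of_ne_zero h (s y)
      exact ⟨c, fun _ => hc⟩
  choose u hu using this
  exact ⟨u, (he.eventually_ne_zero h0).mono fun y hy => hu y hy⟩

/-- A holomorphic frame of a line bundle near a point. -/
def IsFrameAt (e : ∀ x, L₁ x) (x : M) : Prop :=
  ∀ᶠ y in 𝓝 x, HolomorphicSectionAt e y ∧ e y ≠ 0

theorem smul_left_cancel_of_ne_zero {y : M} {e : L₁ y} (he : e ≠ 0) {a b : ℂ}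
    (h : a • e = b • e) : a = b := by
  have hy := mem_baseSet_trivializationAt ℂ L₁ y
  have h1 := trivializationAt_smul hy a e
  rw [h, trivializationAt_smul hy b e] at h1
  exact (mul_right_cancel₀ (trivializationAt_ne_zero hy he) h1).symm

theorem smul_eq_zero_of_fiber {y : M} {e : L₁ y} (he : e ≠ 0) {a : ℂ} (h : a • e = 0) : a = 0 :=
  smul_left_cancel_of_ne_zero he (h.trans (zero_smul ℂ e).symm)

/-- `IsSmooth` controls a coefficient only at the centre of its own frames, so at each `y` near `x`
the frames centred at `y` are compared with the given ones. The factors are `r` from `L₂` and the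
conjugate of `q` from the tangent bundle, because `η` is conjugate-linear; both are smooth. -/
theorem Form01Hom.IsSmooth.exists_coefficient [ContMDiffVectorBundle ω ℂ L₂ 𝓘(ℂ)]
    (hη : η.IsSmooth) {x : M} {e₁ : ∀ x, L₁ x} {e₂ : ∀ x, L₂ x} (h₁ : IsFrameAt e₁ x)
    (h₂ : IsFrameAt e₂ x) :
    ∃ K : ℂ → ℂ, (∀ᶠ w in 𝓝 (chartAt ℂ x x), ContDiffAt ℝ ∞ K w) ∧
      ∀ᶠ y in 𝓝 x, η y (coordVector x y) (e₂ y) = K (chartAt ℂ x y) • e₁ y := by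
  have hex : ∀ y, ∃ c : ℂ, e₁ y ≠ 0 → η y (coordVector x y) (e₂ y) = c • e₁ y := fun y => by
    by_cases h : e₁ y = 0
    · exact ⟨0, fun h' => absurd h h'⟩
    · obtain ⟨c, hc⟩ := exists_eq_smul_of_ne_zero h (η y (coordVector x y) (e₂ y))
      exact ⟨c, fun _ => hc⟩
  choose k hk using hex
  let φ := chartAt ℂ x
  have hsrc : ∀ᶠ y in 𝓝 x, y ∈ φ.source := φ.open_source.mem_nhds (mem_chart_source ℂ x)
  refine ⟨k ∘ φ.symm, ?_, ?_⟩
  · have key : ∀ᶠ y in 𝓝 x, ContDiffAt ℝ ∞ (k ∘ φ.symm) (φ y) := by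
      filter_upwards [h₁, h₂, hsrc] with y hy₁ hy₂ hys
      rw [← contMDiffAt_comp_chart_iff hys]
      have hyy := mem_chart_source ℂ y
      obtain ⟨r, hr, hre⟩ := hy₂.1.exists_eq_smul
        (holomorphicSectionAt_trivialization_symm (mem_baseSet_trivializationAt ℂ L₂ y))
        (trivialization_symm_one_ne_zero (mem_baseSet_trivializationAt ℂ L₂ y))
      obtain ⟨q, hq, hqe⟩ := (holomorphicSectionAt_coordVector hys).exists_eq_smul
        (holomorphicSectionAt_coordVector hyy) (coordVector_ne_zero hyy)
      obtain ⟨a, ha⟩ := hy₁.1.exists_coefficient hy₁.2 (fun t =>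
        η t (coordVector y t) ((trivializationAt ℂ L₂ y).symm t 1))
      have has := (smoothSectionAt_smul_iff hy₁.1 hy₁.2 ha).1 (hη y)
      have hsm : ContMDiffAt 𝓘(ℝ, ℂ) 𝓘(ℝ, ℂ) ∞
          (fun t => starRingEnd ℂ (q t) * r t * a t) y := by
        have h1 := contMDiffAt_iff_contDiffAt_chart.1 hq.contMDiffAt_real
        have h2 := contMDiffAt_iff_contDiffAt_chart.1 hr.contMDiffAt_real
        have h3 := contMDiffAt_iff_contDiffAt_chart.1 has
        exact contMDiffAt_iff_contDiffAt_chart.2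
          (((Complex.conjCLE.contDiff.contDiffAt.comp _ h1).mul h2).mul h3)
      refine hsm.congr_of_eventuallyEq ?_
      filter_upwards [hre, hqe, ha, hy₁.1.eventually_ne_zero hy₁.2,
        φ.open_source.mem_nhds hys] with t ht1 ht2 ht3 ht4 ht5
      rw [Function.comp_apply, φ.left_inv ht5]
      refine smul_left_cancel_of_ne_zero ht4 ?_
      rw [← hk t ht4, ht1]
      have h6 : η t (coordVector x t) = starRingEnd ℂ (q t) • η t (coordVector y t) :=
        (congrArg (η t) ht2).trans ((η t).map_smulₛₗ (q t) (coordVector y t))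
      rw [map_smul, LinearMap.congr_fun h6, LinearMap.smul_apply, ht3, smul_smul, smul_smul]
      congr 1
      ring
    rw [← φ.map_nhds_eq (mem_chart_source ℂ x)]
    exact key
  · filter_upwards [h₁, hsrc] with y hy hys
    rw [hk y hy.2, Function.comp_apply, φ.left_inv hys]

/-- The equation `D''_η ψ = 0` at the point `y`, for a section `ψ` that is smooth at `y`. -/
def HolomorphicExtEqAt (η : Form01Hom L₁ L₂) (ψ : ∀ x, L₁ x × L₂ x) (y : M) : Prop :=
  SmoothSectionAt (fun t => (ψ t).1) y ∧ SmoothSectionAt (fun t => (ψ t).2) y ∧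
    ∀ v, dbarExt η ψ y v = 0

/-- The equation `D''_η ψ = 0` in coordinates, where `K` is the coefficient of `η`. -/
def PlanarHolomorphicAt (K u₁ u₂ : ℂ → ℂ) (w : ℂ) : Prop :=
  ContDiffAt ℝ ∞ u₁ w ∧ ContDiffAt ℝ ∞ u₂ w ∧ planarDbar u₁ w + u₂ w * K w = 0 ∧
    planarDbar u₂ w = 0

/-- In the frames both components of `D''_η ψ` carry the factor `conj (m v)`, which equals `1` on
the coordinate vector, so that one vector tests the equation. The neighbourhood depends only on the
frames and `K`; hence sections described only off `x` are covered as well. -/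
theorem eventually_holomorphicExtEqAt_iff {x : M} {e₁ : ∀ x, L₁ x} {e₂ : ∀ x, L₂ x}
    (h₁ : IsFrameAt e₁ x) (h₂ : IsFrameAt e₂ x) {K : ℂ → ℂ}
    (hK : ∀ᶠ y in 𝓝 x, η y (coordVector x y) (e₂ y) = K (chartAt ℂ x y) • e₁ y) :
    ∀ᶠ y in 𝓝 x, ∀ (u₁ u₂ : ℂ → ℂ) (ψ : ∀ x, L₁ x × L₂ x),
      (∀ᶠ t in 𝓝 y, ψ t = (u₁ (chartAt ℂ x t) • e₁ t, u₂ (chartAt ℂ x t) • e₂ t)) →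
      (HolomorphicExtEqAt η ψ y ↔ PlanarHolomorphicAt K u₁ u₂ (chartAt ℂ x y)) := by
  have hsrc : ∀ᶠ y in 𝓝 x, y ∈ (chartAt ℂ x).source :=
    (chartAt ℂ x).open_source.mem_nhds (mem_chart_source ℂ x)
  filter_upwards [h₁, h₂, hsrc, hK] with y hy₁ hy₂ hys hKy u₁ u₂ ψ hψy
  rw [HolomorphicExtEqAt, PlanarHolomorphicAt,
    smoothSectionAt_smul_iff hy₁.1 hy₁.2 (hψy.mono fun t ht => congrArg Prod.fst ht),
    smoothSectionAt_smul_iff hy₂.1 hy₂.2 (hψy.mono fun t ht => congrArg Prod.snd ht),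
    contMDiffAt_comp_chart_iff hys, contMDiffAt_comp_chart_iff hys]
  refine and_congr_right fun hu₁ => and_congr_right fun hu₂ => ?_
  let m : ℂ := deriv (chartAt ℂ x ∘ (chartAt ℂ y).symm) (chartAt ℂ y y)
  have hm : m * coordVector x y = 1 := deriv_transition_mul_coordVector hys
  have hform : ∀ v : ℂ, η y v (e₂ y) = starRingEnd ℂ (m * v) • K (chartAt ℂ x y) • e₁ y := by
    intro v
    have hv : v = (m * v) • coordVector x y := by
      rw [smul_eq_mul]
      linear_combination (-v) * hm
    have h6 : η y v = starRingEnd ℂ (m * v) • η y (coordVector x y) :=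
      (congrArg (η y) hv).trans ((η y).map_smulₛₗ (m * v) (coordVector x y))
    rw [LinearMap.congr_fun h6, LinearMap.smul_apply, hKy]
  have hd : ∀ v : ℂ, dbarExt η ψ y v =
      ((starRingEnd ℂ (m * v) * (planarDbar u₁ (chartAt ℂ x y) +
        u₂ (chartAt ℂ x y) * K (chartAt ℂ x y))) • e₁ y,
        (starRingEnd ℂ (m * v) * planarDbar u₂ (chartAt ℂ x y)) • e₂ y) := by
    intro v
    have hd1 := dbarSection_smul (u := fun t => u₁ (chartAt ℂ x t)) (s := fun t => (ψ t).1) hy₁.1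
      ((contMDiffAt_comp_chart_iff hys).2 hu₁)
      (hψy.mono fun t ht => congrArg Prod.fst ht) v
    have hd2 := dbarSection_smul (u := fun t => u₂ (chartAt ℂ x t)) (s := fun t => (ψ t).2) hy₂.1
      ((contMDiffAt_comp_chart_iff hys).2 hu₂)
      (hψy.mono fun t ht => congrArg Prod.snd ht) v
    have h1 := dbar_comp_chart hys hu₁ v
    have h2 := dbar_comp_chart hys hu₂ v
    have h3 : (ψ y).2 = u₂ (chartAt ℂ x y) • e₂ y := congrArg Prod.snd hψy.self_of_nhds
    have h1' := hd1.trans (congrArg (· • e₁ y) h1)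
    have h2' := hd2.trans (congrArg (· • e₂ y) h2)
    have h4 : η y v (ψ y).2 = u₂ (chartAt ℂ x y) •
        starRingEnd ℂ (m * v) • K (chartAt ℂ x y) • e₁ y := by
      rw [h3, map_smul]
      exact congrArg _ (hform v)
    refine Prod.ext ?_ ?_
    · refine (congrArg₂ (· + ·) h1' h4).trans ?_
      simp only [smul_smul, ← add_smul]
      congr 1
      ring
    · refine h2'.trans ?_
      rw [mul_comm]
  constructor
  · intro h
    have h1 := (hd (coordVector x y)).symm.trans (h (coordVector x y))
    rw [hm, map_one, one_mul, one_mul] at h1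
    exact ⟨smul_eq_zero_of_fiber hy₁.2 (congrArg Prod.fst h1),
      smul_eq_zero_of_fiber hy₂.2 (congrArg Prod.snd h1)⟩
  · rintro ⟨h1, h2⟩ v
    refine (hd v).trans ?_
    rw [h1, h2]
    simp

theorem eventually_nhdsNE_chart_iff {x : M} {p : ℂ → Prop} :
    (∀ᶠ w in 𝓝[≠] (chartAt ℂ x x), p w) ↔ ∀ᶠ y in 𝓝[≠] x, p (chartAt ℂ x y) := by
  have hx := mem_chart_source ℂ x
  rw [eventually_nhdsWithin_iff, eventually_nhdsWithin_iff, ← (chartAt ℂ x).map_nhds_eq hx,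
    eventually_map]
  refine eventually_congr ?_
  filter_upwards [(chartAt ℂ x).open_source.mem_nhds hx] with y hy
  have : chartAt ℂ x y = chartAt ℂ x x ↔ y = x := (chartAt ℂ x).injOn.eq_iff hy hx
  simp [this]

theorem eventually_nhds_chart_iff {x : M} {p : ℂ → Prop} :
    (∀ᶠ w in 𝓝 (chartAt ℂ x x), p w) ↔ ∀ᶠ y in 𝓝 x, p (chartAt ℂ x y) := by
  rw [← (chartAt ℂ x).map_nhds_eq (mem_chart_source ℂ x), eventually_map]

theorem holomorphicExtAt_iff {x : M} {e₁ : ∀ x, L₁ x} {e₂ : ∀ x, L₂ x} (h₁ : IsFrameAt e₁ x)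
    (h₂ : IsFrameAt e₂ x) {K : ℂ → ℂ}
    (hK : ∀ᶠ y in 𝓝 x, η y (coordVector x y) (e₂ y) = K (chartAt ℂ x y) • e₁ y)
    {u₁ u₂ : ℂ → ℂ} {ψ : ∀ x, L₁ x × L₂ x}
    (hψ : ∀ᶠ y in 𝓝 x, ψ y = (u₁ (chartAt ℂ x y) • e₁ y, u₂ (chartAt ℂ x y) • e₂ y)) :
    HolomorphicExtAt η ψ x ↔
      ∀ᶠ w in 𝓝 (chartAt ℂ x x), PlanarHolomorphicAt K u₁ u₂ w := by
  rw [eventually_nhds_chart_iff]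
  refine eventually_congr ?_
  filter_upwards [eventually_holomorphicExtEqAt_iff h₁ h₂ hK, hψ.eventually_nhds] with y hy hψy
    using hy u₁ u₂ ψ hψy

theorem eventually_nhdsNE_holomorphicExtEqAt_iff {x : M} {e₁ : ∀ x, L₁ x} {e₂ : ∀ x, L₂ x}
    (h₁ : IsFrameAt e₁ x) (h₂ : IsFrameAt e₂ x) {K : ℂ → ℂ}
    (hK : ∀ᶠ y in 𝓝 x, η y (coordVector x y) (e₂ y) = K (chartAt ℂ x y) • e₁ y)
    {u₁ u₂ : ℂ → ℂ} {ψ : ∀ x, L₁ x × L₂ x} [T1Space M]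
    (hψ : ∀ᶠ y in 𝓝[≠] x, ψ y = (u₁ (chartAt ℂ x y) • e₁ y, u₂ (chartAt ℂ x y) • e₂ y)) :
    (∀ᶠ y in 𝓝[≠] x, HolomorphicExtEqAt η ψ y) ↔
      ∀ᶠ w in 𝓝[≠] (chartAt ℂ x x), PlanarHolomorphicAt K u₁ u₂ w := by
  rw [eventually_nhdsNE_chart_iff]
  refine eventually_congr ?_
  filter_upwards [(eventually_holomorphicExtEqAt_iff h₁ h₂ hK).filter_mono nhdsWithin_le_nhds,
    eventually_eventually_nhdsWithin.2 hψ, self_mem_nhdsWithin] with y hy hψy hyx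
  rw [isOpen_compl_singleton.nhdsWithin_eq hyx] at hψy
  exact hy u₁ u₂ ψ hψy

end Extension

section PlanarExtension

/-! ### Local analysis of the extension in coordinates -/

theorem ContDiffAt.differentiableAt_real {u : ℂ → ℂ} {w : ℂ} (h : ContDiffAt ℝ ∞ u w) :
    DifferentiableAt ℝ u w := h.differentiableAt (by simp)

theorem contDiff_planarDbar {u : ℂ → ℂ} (hu : ContDiff ℝ ∞ u) : ContDiff ℝ ∞ (planarDbar u) := by
  have h : ContDiff ℝ ∞ (fderiv ℝ u) := hu.fderiv_right (by simp)
  exact contDiff_const.mul ((h.clm_apply contDiff_const).add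
    (contDiff_const.mul (h.clm_apply contDiff_const)))

theorem planarDbar_holomorphic_mul {a u : ℂ → ℂ} {w : ℂ} (ha : DifferentiableAt ℂ a w)
    (hu : DifferentiableAt ℝ u w) :
    planarDbar (fun t => a t * u t) w = a w * planarDbar u w := by
  rw [planarDbar_mul (ha.restrictScalars ℝ) hu, ha.planarDbar_eq_zero, zero_mul, zero_add]

theorem PlanarHolomorphicAt.holomorphic_mul {K u₁ u₂ a : ℂ → ℂ} {w : ℂ}
    (h : PlanarHolomorphicAt K u₁ u₂ w) (ha : AnalyticAt ℂ a w) :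
    PlanarHolomorphicAt K (fun t => a t * u₁ t) (fun t => a t * u₂ t) w := by
  obtain ⟨h1, h2, h3, h4⟩ := h
  refine ⟨ha.contDiffAt_real.mul h1, ha.contDiffAt_real.mul h2, ?_, ?_⟩
  · rw [planarDbar_holomorphic_mul ha.differentiableAt h1.differentiableAt_real]
    linear_combination a w * h3
  · rw [planarDbar_holomorphic_mul ha.differentiableAt h2.differentiableAt_real, h4, mul_zero]

/-- A smooth cutoff equal to `1` near `0`, supported in a given neighbourhood of `0`. -/
theorem exists_smooth_cutoff {p : ℂ → Prop} (hp : ∀ᶠ w in 𝓝 (0 : ℂ), p w) :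
    ∃ χ : ℂ → ℂ, ContDiff ℝ ∞ χ ∧ HasCompactSupport χ ∧ (∀ᶠ w in 𝓝 (0 : ℂ), χ w = 1) ∧
      ∀ w ∈ tsupport χ, p w := by
  obtain ⟨r, hr, hball⟩ := Metric.eventually_nhds_iff_ball.1 hp
  let f : ContDiffBump (0 : ℂ) := ⟨r / 4, r / 2, by linarith, by linarith⟩
  refine ⟨fun w => (f w : ℂ), Complex.ofRealCLM.contDiff.comp f.contDiff, ?_, ?_, ?_⟩
  · exact f.hasCompactSupport.comp_left (g := fun t : ℝ => (t : ℂ)) Complex.ofReal_zero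
  · filter_upwards [f.eventuallyEq_one] with w hw
    rw [hw]
    simp
  · intro w hw
    have h1 : w ∈ tsupport f :=
      closure_mono (Function.support_comp_subset (g := fun t : ℝ => (t : ℂ))
        Complex.ofReal_zero f) hw
    rw [f.tsupport_eq] at h1
    exact hball w (Metric.closedBall_subset_ball (by simp only [f]; linarith) h1)

/-- The product of a cutoff with a function that is smooth near its support is smooth. -/
theorem contDiff_cutoff_mul {χ K : ℂ → ℂ} (hχ : ContDiff ℝ ∞ χ)
    (hK : ∀ w ∈ tsupport χ, ContDiffAt ℝ ∞ K w) : ContDiff ℝ ∞ (fun w => χ w * K w) := by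
  rw [contDiff_iff_contDiffAt]
  intro w
  by_cases hw : w ∈ tsupport χ
  · exact hχ.contDiffAt.mul (hK w hw)
  · refine contDiffAt_const (c := (0 : ℂ)) |>.congr_of_eventuallyEq ?_
    filter_upwards [(isClosed_tsupport χ).isOpen_compl.mem_nhds hw] with t ht
    rw [image_eq_zero_of_notMem_tsupport ht, zero_mul]

/-- Local solvability of `∂g/∂z̄ = -K`, with a globally smooth solution. -/
theorem exists_planarDbar_eq_neg_near_zero {K : ℂ → ℂ}
    (hK : ∀ᶠ w in 𝓝 (0 : ℂ), ContDiffAt ℝ ∞ K w) :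
    ∃ g : ℂ → ℂ, ContDiff ℝ ∞ g ∧ ∀ᶠ w in 𝓝 (0 : ℂ), planarDbar g w = -K w := by
  obtain ⟨χ, hχ, hχc, hχ1, hχK⟩ := exists_smooth_cutoff hK
  obtain ⟨g, hg, hge, -⟩ := exists_planarDbar_eq (contDiff_cutoff_mul hχ hχK).neg
    (b := fun w => -(χ w * K w)) (hχc.mul_right.neg)
  refine ⟨g, hg, ?_⟩
  filter_upwards [hχ1] with w hw
  rw [hge, hw, one_mul]

/-- A holomorphic germ divided by the largest power of the coordinate of exponent at most `n`. -/
theorem exists_eq_pow_mul_of_analyticAt {k : ℂ → ℂ} (hk : AnalyticAt ℂ k 0) (n : ℕ) :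
    ∃ (j : ℕ) (k' : ℂ → ℂ), j ≤ n ∧ AnalyticAt ℂ k' 0 ∧ (j = n ∨ k' 0 ≠ 0) ∧
      ∀ᶠ w in 𝓝 (0 : ℂ), k w = w ^ j * k' w := by
  by_cases h : ∃ k', AnalyticAt ℂ k' 0 ∧ ∀ᶠ w in 𝓝 (0 : ℂ), k w = w ^ n * k' w
  · obtain ⟨k', h1, h2⟩ := h
    exact ⟨n, k', le_rfl, h1, Or.inl rfl, h2⟩
  · rcases hk.exists_eventuallyEq_pow_smul_nonzero_iff.2 (fun h0 => h ⟨0, analyticAt_const, by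
      simpa using h0⟩) with ⟨j, k', h1, h2, h3⟩
    simp only [sub_zero, smul_eq_mul] at h3
    refine ⟨j, k', ?_, h1, Or.inr h2, h3⟩
    by_contra hlt
    push Not at hlt
    refine h ⟨fun w => w ^ (j - n) * k' w, (analyticAt_id.pow _).mul h1, ?_⟩
    filter_upwards [h3] with w hw
    rw [hw, ← mul_assoc, ← pow_add, Nat.add_sub_cancel' hlt.le]

/-- The meromorphic section `(F ζ₁, ζ₂)` near the north pole. -/
theorem exists_regular_representative {K κ g : ℂ → ℂ} (hκ : AnalyticAt ℂ κ 0)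
    (hg : ContDiff ℝ ∞ g) (hgK : ∀ᶠ w in 𝓝 (0 : ℂ), planarDbar g w = -K w) {d₁ d₂ : ℤ} {n : ℕ}
    (hn : d₂ = d₁ + n) :
    ∃ (m : ℤ) (s₁ s₂ : ℂ → ℂ), (∀ᶠ w in 𝓝 (0 : ℂ), PlanarHolomorphicAt K s₁ s₂ w) ∧
      (s₁ 0 ≠ 0 ∨ s₂ 0 ≠ 0) ∧ ∀ᶠ w in 𝓝[≠] (0 : ℂ),
        (κ w + w ^ n * g w) * w ^ d₁ = w ^ m * s₁ w ∧ w ^ d₂ = w ^ m * s₂ w := by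
  obtain ⟨j, k, hjn, hk, hjk, hkw⟩ := exists_eq_pow_mul_of_analyticAt hκ n
  obtain ⟨i, rfl⟩ := Nat.exists_eq_add_of_le hjn
  -- Here `j` is the smaller of `n` and the order of `κ`, and `i = n - j`. If `i = 0` the second
  -- component is `1`; otherwise `k 0 ≠ 0` while `w ^ i g` vanishes at `0`. So the remaining section
  -- is nonzero at `0`.
  refine ⟨d₁ + j, fun w => k w + w ^ i * g w, fun w => w ^ i, ?_, ?_, ?_⟩
  · filter_upwards [hgK, hk.eventually_analyticAt] with w hw hkw
    have hp : AnalyticAt ℂ (fun w : ℂ => w ^ i) w := analyticAt_id.pow i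
    have hpg : ContDiffAt ℝ ∞ (fun w : ℂ => w ^ i * g w) w := hp.contDiffAt_real.mul hg.contDiffAt
    refine ⟨hkw.contDiffAt_real.add hpg, hp.contDiffAt_real, ?_,
      hp.differentiableAt.planarDbar_eq_zero⟩
    rw [planarDbar_add (hkw.differentiableAt.restrictScalars ℝ) hpg.differentiableAt_real,
      planarDbar_holomorphic_mul hp.differentiableAt hg.contDiffAt.differentiableAt_real,
      hkw.differentiableAt.planarDbar_eq_zero, hw]
    ring
  · rcases Nat.eq_zero_or_pos i with rfl | hi
    · right
      simp
    · left
      have := hjk.resolve_left (by omega)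
      simpa [hi.ne'] using this
  · filter_upwards [hkw.filter_mono nhdsWithin_le_nhds, self_mem_nhdsWithin] with w hw hw0
    have hw0 : w ≠ 0 := hw0
    rw [hw, hn, zpow_add₀ hw0 d₁ j, zpow_add₀ hw0 d₁, zpow_natCast, zpow_natCast]
    constructor <;> ring

/-- The quotient of the first components of two meromorphic solutions with the same second
component is meromorphic. -/
theorem meromorphicAt_of_planarHolomorphic {K S₁ S₂ t F H : ℂ → ℂ} {w₀ : ℂ} {n : ℕ} {δ₁ δ₂ : ℤ}
    (hS : ∀ᶠ w in 𝓝 w₀, PlanarHolomorphicAt K S₁ S₂ w)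
    (ht : AnalyticAt ℂ t w₀) (ht0 : t w₀ ≠ 0)
    (hSt : ∀ᶠ w in 𝓝 w₀, S₂ w = (w - w₀) ^ n * t w)
    (hFc : ContinuousAt F w₀)
    (hF : ∀ᶠ w in 𝓝[≠] w₀, PlanarHolomorphicAt K (fun w => F w * (w - w₀) ^ δ₁)
      (fun w => (w - w₀) ^ δ₂) w)
    (hH : ∀ᶠ w in 𝓝[≠] w₀, (F w + H w) * (w - w₀) ^ δ₁ * S₂ w = (w - w₀) ^ δ₂ * S₁ w) :
    MeromorphicAt H w₀ := by
  -- Formally `F + H = c ^ (δ₂ - δ₁ - n) t⁻¹ S₁` with `c = w - w₀`. Multiplication by `c ^ N` makes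
  -- the exponent a natural number `j`.
  obtain ⟨N, j, hNj⟩ : ∃ N j : ℕ, (N : ℤ) + (δ₂ - δ₁) = j + n := by
    refine ⟨(n - (δ₂ - δ₁)).toNat, ((δ₂ - δ₁) - n).toNat, ?_⟩
    omega
  let G : ℂ → ℂ := fun w => (w - w₀) ^ j * (t w)⁻¹ * S₁ w - (w - w₀) ^ N * F w
  have hta := ht.eventually_analyticAt
  have htne := ht.continuousAt.eventually_ne ht0
  -- `G` is `c ^ N H` off `w₀`. Both of its terms have `∂̄` equal to `-c ^ (j + n) K`, so `G` is
  -- holomorphic off `w₀`; it is continuous at `w₀`, so the singularity is removable.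
  have hGan : AnalyticAt ℂ G w₀ := by
    refine Complex.analyticAt_of_differentiable_on_punctured_nhds_of_continuousAt ?_ ?_
    · filter_upwards [hF, hS.filter_mono nhdsWithin_le_nhds, hta.filter_mono nhdsWithin_le_nhds,
        htne.filter_mono nhdsWithin_le_nhds, hSt.filter_mono nhdsWithin_le_nhds,
        self_mem_nhdsWithin, eventually_eventually_nhdsWithin.2 hF] with w hwF hwS hwt hwt0 hwSt hw0 hwF'
      have hc0 : w - w₀ ≠ 0 := sub_ne_zero.2 hw0
      have hcz : ∀ d : ℤ, AnalyticAt ℂ (fun w => (w - w₀) ^ d) w := fun d =>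
        (analyticAt_id.sub analyticAt_const).zpow hc0
      have hcp : ∀ d : ℕ, AnalyticAt ℂ (fun w => (w - w₀) ^ d) w := fun d =>
        (analyticAt_id.sub analyticAt_const).pow d
      have hFsm : ContDiffAt ℝ ∞ F w := by
        refine (hwF.1.mul (hcz (-δ₁)).contDiffAt_real).congr_of_eventuallyEq ?_
        filter_upwards [isOpen_ne.mem_nhds hw0] with v hv
        have hv0 : v - w₀ ≠ 0 := sub_ne_zero.2 hv
        rw [mul_assoc, ← zpow_add₀ hv0]
        simp
      have hFd : planarDbar F w * (w - w₀) ^ δ₁ + (w - w₀) ^ δ₂ * K w = 0 := by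
        have h := hwF.2.2.1
        rw [planarDbar_mul hFsm.differentiableAt_real
          ((hcz δ₁).differentiableAt.restrictScalars ℝ),
          (hcz δ₁).differentiableAt.planarDbar_eq_zero, mul_zero, add_zero] at h
        exact h
      have ha : AnalyticAt ℂ (fun w => (w - w₀) ^ j * (t w)⁻¹) w := (hcp j).mul (hwt.inv hwt0)
      have hd1 : DifferentiableAt ℝ (fun w => (w - w₀) ^ j * (t w)⁻¹ * S₁ w) w :=
        (ha.differentiableAt.restrictScalars ℝ).mul hwS.1.differentiableAt_real
      have hd2 : DifferentiableAt ℝ (fun w => (w - w₀) ^ N * F w) w :=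
        ((hcp N).differentiableAt.restrictScalars ℝ).mul hFsm.differentiableAt_real
      refine differentiableAt_of_planarDbar_eq_zero (hd1.sub hd2) ?_
      change planarDbar (fun w => (w - w₀) ^ j * (t w)⁻¹ * S₁ w - (w - w₀) ^ N * F w) w = 0
      rw [planarDbar_sub hd1 hd2,
        planarDbar_holomorphic_mul ha.differentiableAt hwS.1.differentiableAt_real,
        planarDbar_holomorphic_mul (hcp N).differentiableAt hFsm.differentiableAt_real]
      have h1 := hwS.2.2.1
      rw [hwSt] at h1
      have hpow : (w - w₀) ^ N * (w - w₀) ^ δ₂ = (w - w₀) ^ j * (w - w₀) ^ n * (w - w₀) ^ δ₁ := by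
        rw [← zpow_natCast, ← zpow_natCast, ← zpow_natCast, ← zpow_add₀ hc0, ← zpow_add₀ hc0,
          ← zpow_add₀ hc0]
        congr 1
        omega
      have hδ : (w - w₀) ^ δ₁ ≠ 0 := zpow_ne_zero _ hc0
      refine (mul_eq_zero.1 (?_ : _ * (w - w₀) ^ δ₁ = 0)).resolve_right hδ
      have h2 : planarDbar S₁ w = -((w - w₀) ^ n * t w * K w) := by linear_combination h1
      rw [h2]
      have h3 : t w * (t w)⁻¹ = 1 := mul_inv_cancel₀ hwt0
      linear_combination -(w - w₀) ^ N * hFd + K w * hpow -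
        (w - w₀) ^ j * (w - w₀) ^ n * (w - w₀) ^ δ₁ * K w * h3
    · have hS₁ : ContinuousAt S₁ w₀ := hS.self_of_nhds.1.continuousAt
      have h1 := ht.continuousAt.inv₀ ht0
      have hc : ContinuousAt (fun w : ℂ => w - w₀) w₀ := by fun_prop
      exact (((hc.pow j).mul h1).mul hS₁).sub ((hc.pow N).mul hFc)
  have hmer : MeromorphicAt (fun w => ((w - w₀) ^ N)⁻¹ * G w) w₀ :=
    (((analyticAt_id.sub analyticAt_const).pow N).meromorphicAt.inv).mul hGan.meromorphicAt
  refine hmer.congr ?_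
  filter_upwards [hH, htne.filter_mono nhdsWithin_le_nhds, hSt.filter_mono nhdsWithin_le_nhds,
    self_mem_nhdsWithin] with w hw hwt0 hwSt hw0
  have hc0 : w - w₀ ≠ 0 := sub_ne_zero.2 hw0
  have hδ : (w - w₀) ^ δ₁ ≠ 0 := zpow_ne_zero _ hc0
  have hpow : (w - w₀) ^ N * (w - w₀) ^ δ₂ = (w - w₀) ^ j * (w - w₀) ^ n * (w - w₀) ^ δ₁ := by
    rw [← zpow_natCast, ← zpow_natCast, ← zpow_natCast, ← zpow_add₀ hc0, ← zpow_add₀ hc0,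
      ← zpow_add₀ hc0]
    congr 1
    omega
  have hcN : (w - w₀) ^ N ≠ 0 := pow_ne_zero _ hc0
  have hcn : (w - w₀) ^ n ≠ 0 := pow_ne_zero _ hc0
  rw [inv_mul_eq_iff_eq_mul₀ hcN]
  rw [hwSt] at hw
  have h3 : t w * (t w)⁻¹ = 1 := mul_inv_cancel₀ hwt0
  refine mul_left_cancel₀ (mul_ne_zero (mul_ne_zero hδ hcn) hwt0) ?_
  simp only [G]
  linear_combination -(w - w₀) ^ N * hw - S₁ w * hpow +
    (w - w₀) ^ δ₁ * (w - w₀) ^ n * (w - w₀) ^ j * S₁ w * h3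

end PlanarExtension

section LineSubbundle

/-! ### Line subbundles in local frames -/

variable {M : Type*} [TopologicalSpace M] [ChartedSpace ℂ M] [IsManifold 𝓘(ℂ) ω M]
  [IsManifold 𝓘(ℂ) 1 M]
  {L₁ L₂ : M → Type*}
  [∀ x, AddCommGroup (L₁ x)] [∀ x, Module ℂ (L₁ x)] [∀ x, TopologicalSpace (L₁ x)]
  [TopologicalSpace (TotalSpace ℂ L₁)] [FiberBundle ℂ L₁] [VectorBundle ℂ ℂ L₁]
  [∀ x, AddCommGroup (L₂ x)] [∀ x, Module ℂ (L₂ x)] [∀ x, TopologicalSpace (L₂ x)]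
  [TopologicalSpace (TotalSpace ℂ L₂)] [FiberBundle ℂ L₂] [VectorBundle ℂ ℂ L₂]
  {η : Form01Hom L₁ L₂} {J : ∀ x : M, Submodule ℂ (L₁ x × L₂ x)}

theorem HolomorphicSectionAt.isFrameAt [ContMDiffVectorBundle ω ℂ L₁ 𝓘(ℂ)] {e : ∀ x, L₁ x} {x : M}
    (he : HolomorphicSectionAt e x) (h0 : e x ≠ 0) : IsFrameAt e x :=
  ((contMDiffAt_iff_contMDiffAt_nhds (by simp)).1 he).and (he.eventually_ne_zero h0)

theorem span_singleton_eq_firstSummand_iff {y : M} {σ : L₁ y × L₂ y} (hσ : σ ≠ 0) :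
    Submodule.span ℂ {σ} = firstSummand L₁ L₂ y ↔ σ.2 = 0 := by
  constructor
  · intro h
    have : σ ∈ firstSummand L₁ L₂ y := h ▸ Submodule.mem_span_singleton_self σ
    exact (Submodule.mem_bot ℂ).1 this.2
  · intro h
    have h1 : σ.1 ≠ 0 := fun h1 => hσ (Prod.ext h1 h)
    ext v
    rw [Submodule.mem_span_singleton, firstSummand, Submodule.mem_prod]
    constructor
    · rintro ⟨a, rfl⟩
      simp [h]
    · rintro ⟨-, hv⟩
      obtain ⟨c, hc⟩ := exists_eq_smul_of_ne_zero h1 v.1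
      refine ⟨c, Prod.ext hc.symm ?_⟩
      rw [(Submodule.mem_bot ℂ).1 hv, Prod.smul_snd, h, smul_zero]

theorem exists_coefficients {e₁ : ∀ x, L₁ x} {e₂ : ∀ x, L₂ x} {x : M} (h₁ : IsFrameAt e₁ x)
    (h₂ : IsFrameAt e₂ x) (σ : ∀ x, L₁ x × L₂ x) :
    ∃ S₁ S₂ : ℂ → ℂ, ∀ᶠ y in 𝓝 x,
      σ y = (S₁ (chartAt ℂ x y) • e₁ y, S₂ (chartAt ℂ x y) • e₂ y) := by
  obtain ⟨u₁, hu₁⟩ := h₁.self_of_nhds.1.exists_coefficient h₁.self_of_nhds.2 (fun y => (σ y).1)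
  obtain ⟨u₂, hu₂⟩ := h₂.self_of_nhds.1.exists_coefficient h₂.self_of_nhds.2 (fun y => (σ y).2)
  refine ⟨u₁ ∘ (chartAt ℂ x).symm, u₂ ∘ (chartAt ℂ x).symm, ?_⟩
  filter_upwards [hu₁, hu₂, (chartAt ℂ x).open_source.mem_nhds (mem_chart_source ℂ x)]
    with y hy₁ hy₂ hy
  rw [Function.comp_apply, Function.comp_apply, (chartAt ℂ x).left_inv hy, ← hy₁, ← hy₂]

/-- `D''_η` is upper triangular, so the second component satisfies the homogeneous equation. -/
theorem PlanarHolomorphicAt.analyticAt_snd {K S₁ S₂ : ℂ → ℂ} {w : ℂ}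
    (h : ∀ᶠ v in 𝓝 w, PlanarHolomorphicAt K S₁ S₂ v) : AnalyticAt ℂ S₂ w :=
  analyticAt_of_planarDbar_eq_zero (h.mono fun _ hv => ⟨hv.2.1.differentiableAt_real, hv.2.2.2⟩)

theorem eventually_eq_firstSummand_iff {e₁ : ∀ x, L₁ x} {e₂ : ∀ x, L₂ x} {x : M}
    (h₂ : IsFrameAt e₂ x) {σ : ∀ x, L₁ x × L₂ x} {S₁ S₂ : ℂ → ℂ}
    (hσJ : ∀ᶠ y in 𝓝 x, σ y ≠ 0 ∧ J y = Submodule.span ℂ {σ y})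
    (hσ : ∀ᶠ y in 𝓝 x, σ y = (S₁ (chartAt ℂ x y) • e₁ y, S₂ (chartAt ℂ x y) • e₂ y)) :
    ∀ᶠ y in 𝓝 x, (J y = firstSummand L₁ L₂ y ↔ S₂ (chartAt ℂ x y) = 0) := by
  filter_upwards [h₂, hσJ, hσ] with y hy₂ hyJ hyσ
  rw [hyJ.2, span_singleton_eq_firstSummand_iff hyJ.1, hyσ]
  exact ⟨fun h => smul_eq_zero_of_fiber hy₂.2 h, fun h => by rw [h, zero_smul]⟩

variable [ContMDiffVectorBundle ω ℂ L₁ 𝓘(ℂ)] [ContMDiffVectorBundle ω ℂ L₂ 𝓘(ℂ)]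

theorem isFrameAt_trivialization_symm (x : M) :
    IsFrameAt (fun y => (trivializationAt ℂ L₁ x).symm y (1 : ℂ)) x :=
  (eventually_mem_baseSet_trivializationAt (L := L₁) x).mono fun _ hy =>
    ⟨holomorphicSectionAt_trivialization_symm hy, trivialization_symm_one_ne_zero hy⟩

/-- `J` agrees with `L₁` at the zeros of the holomorphic function `S₂`, which are isolated unless
`S₂` vanishes near the point. -/
theorem IsLineSubbundle.eventually_eq_or_eventually_ne (hJ : IsLineSubbundle η J)
    (hη : η.IsSmooth) (x : M) :
    (∀ᶠ y in 𝓝 x, J y = firstSummand L₁ L₂ y) ∨ ∀ᶠ y in 𝓝[≠] x, J y ≠ firstSummand L₁ L₂ y := by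
  have h₁ := isFrameAt_trivialization_symm (L₁ := L₁) x
  have h₂ := isFrameAt_trivialization_symm (L₁ := L₂) x
  obtain ⟨K, -, hK⟩ := hη.exists_coefficient h₁ h₂
  obtain ⟨σ, hσ, hσJ⟩ := hJ x
  obtain ⟨S₁, S₂, hS⟩ := exists_coefficients h₁ h₂ σ
  have hiff := eventually_eq_firstSummand_iff h₂ hσJ hS
  have han := PlanarHolomorphicAt.analyticAt_snd ((holomorphicExtAt_iff h₁ h₂ hK hS).1 hσ)
  refine han.eventually_eq_zero_or_eventually_ne_zero.imp (fun h => ?_) fun h => ?_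
  · filter_upwards [hiff, eventually_nhds_chart_iff.1 h] with y hy hy0 using hy.2 hy0
  · filter_upwards [hiff.filter_mono nhdsWithin_le_nhds, eventually_nhdsNE_chart_iff.1 h]
      with y hy hy0 using fun h => hy0 (hy.1 h)

theorem IsLineSubbundle.eventually_ne_firstSummand [PreconnectedSpace M] [T1Space M]
    [∀ x : M, (𝓝[≠] x).NeBot]
    (hJ : IsLineSubbundle η J) (hη : η.IsSmooth) (hne : J ≠ firstSummand L₁ L₂) (x : M) :
    ∀ᶠ y in 𝓝[≠] x, J y ≠ firstSummand L₁ L₂ y := by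
  -- The local dichotomy makes this open set closed as well. By connectedness it is empty, since
  -- otherwise `J = L₁` everywhere.
  let A : Set M := {x | ∀ᶠ y in 𝓝 x, J y = firstSummand L₁ L₂ y}
  have hA : IsOpen A := isOpen_iff_mem_nhds.2 fun x hx => eventually_eventually_nhds.2 hx
  have hAc : IsOpen Aᶜ := by
    refine isOpen_iff_mem_nhds.2 fun x hx => ?_
    have h := (hJ.eventually_eq_or_eventually_ne hη x).resolve_left hx
    have h2 : ∀ᶠ y in 𝓝[≠] x, y ∈ Aᶜ := h.mono fun y hy hyA => hy (Filter.Eventually.self_of_nhds (p := fun z => J z = firstSummand L₁ L₂ z) hyA)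
    rw [eventually_nhdsWithin_iff] at h2
    filter_upwards [h2] with y hy
    by_cases hyx : y = x
    · exact hyx ▸ hx
    · exact hy hyx
  rcases isClopen_iff.1 ⟨⟨hAc⟩, hA⟩ with h | h
  · exact (hJ.eventually_eq_or_eventually_ne hη x).resolve_left fun hx =>
      (Set.eq_empty_iff_forall_notMem.1 h x) hx
  · exact absurd (funext fun y => Filter.Eventually.self_of_nhds
      (p := fun z => J z = firstSummand L₁ L₂ z) (h ▸ Set.mem_univ y : y ∈ A)) hne

theorem finite_of_eventually_notMem {X : Type*} [TopologicalSpace X] [CompactSpace X] {s : Set X}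
    (h : ∀ x, ∀ᶠ y in 𝓝[≠] x, y ∉ s) : s.Finite := by
  by_contra hs
  obtain ⟨x, hx⟩ := Set.Infinite.exists_accPt_principal hs
  obtain ⟨y, hy, hy'⟩ := ((accPt_iff_frequently_nhdsNE.1 hx).and_eventually (h x)).exists
  exact hy' hy

end LineSubbundle

/-! ### The preferred charts of the sphere -/

namespace RiemannSphere

theorem chartAt_infty : chartAt ℂ (OnePoint.infty : RiemannSphere) = wChart := if_pos rfl

theorem chartAt_of_ne {x : RiemannSphere} (hx : x ≠ OnePoint.infty) : chartAt ℂ x = zChart :=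
  if_neg hx

end RiemannSphere

section Sphere

variable {L₁ L₂ : RiemannSphere → Type*}
  [∀ x, AddCommGroup (L₁ x)] [∀ x, Module ℂ (L₁ x)] [∀ x, TopologicalSpace (L₁ x)]
  [TopologicalSpace (TotalSpace ℂ L₁)] [FiberBundle ℂ L₁] [VectorBundle ℂ ℂ L₁]
  [ContMDiffVectorBundle ω ℂ L₁ 𝓘(ℂ)]
  [∀ x, AddCommGroup (L₂ x)] [∀ x, Module ℂ (L₂ x)] [∀ x, TopologicalSpace (L₂ x)]
  [TopologicalSpace (TotalSpace ℂ L₂)] [FiberBundle ℂ L₂] [VectorBundle ℂ ℂ L₂]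
  [ContMDiffVectorBundle ω ℂ L₂ 𝓘(ℂ)]
  {ζ₁ : ∀ x, L₁ x} {ζ₂ : ∀ x, L₂ x} {d₁ d₂ : ℤ} {η : Form01Hom L₁ L₂}
  {J : ∀ x, Submodule ℂ (L₁ x × L₂ x)} {f h : RiemannSphere → ℂ}

/-! ### Line subbundles of an extension over the sphere -/

theorem IsCanonicalSection.isFrameAt (hζ : IsCanonicalSection ζ₁ d₁) {x : RiemannSphere}
    (hx : x ≠ OnePoint.infty) : IsFrameAt ζ₁ x :=
  (hζ.holomorphic x hx).isFrameAt (hζ.ne_zero x hx)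

/-- The exponent is `d₁` at `N` and `0` elsewhere, so the north pole and the finite points can be
treated together. -/
theorem IsCanonicalSection.exists_frame (hζ : IsCanonicalSection ζ₁ d₁) (x : RiemannSphere) :
    ∃ (e : ∀ x, L₁ x) (δ : ℤ), IsFrameAt e x ∧
      ∀ᶠ y in 𝓝[≠] x, ζ₁ y = (chartAt ℂ x y - chartAt ℂ x x) ^ δ • e y := by
  by_cases hx : x = OnePoint.infty
  · subst hx
    obtain ⟨e, he, he0, hζe⟩ := hζ.order_north
    refine ⟨e, d₁, he.isFrameAt he0, hζe.mono fun y hy => ?_⟩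
    rw [RiemannSphere.chartAt_infty,
      show RiemannSphere.wChart OnePoint.infty = 0 from rfl, sub_zero, hy]
  · exact ⟨ζ₁, 0, hζ.isFrameAt hx, Eventually.of_forall fun y => by simp⟩

/-- The affine coordinate of the line `J y`. -/
theorem IsLineSubbundle.exists_mem (hJ : IsLineSubbundle η J) (hζ₁ : IsCanonicalSection ζ₁ d₁)
    (f : RiemannSphere → ℂ) {y : RiemannSphere} (hy : y ≠ OnePoint.infty)
    (hyJ : J y ≠ firstSummand L₁ L₂ y) :
    ∃ c : ℂ, ((f y + c) • ζ₁ y, ζ₂ y) ∈ J y := by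
  obtain ⟨σ, -, hσ⟩ := hJ y
  obtain ⟨hσ0, hσJ⟩ := hσ.self_of_nhds
  have h2 : (σ y).2 ≠ 0 := fun h => hyJ (hσJ.trans ((span_singleton_eq_firstSummand_iff hσ0).2 h))
  obtain ⟨a, ha⟩ := exists_eq_smul_of_ne_zero h2 (ζ₂ y)
  obtain ⟨b, hb⟩ := exists_eq_smul_of_ne_zero (hζ₁.ne_zero y hy) (a • (σ y).1)
  refine ⟨b - f y, ?_⟩
  rw [hσJ, Submodule.mem_span_singleton]
  refine ⟨a, Prod.ext ?_ ha.symm⟩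
  rw [add_sub_cancel]
  exact hb

theorem eventually_holomorphicExtEqAt {ψ : ∀ x, L₁ x × L₂ x} (hψ : IsMeromorphicExtSection η ψ)
    (x : RiemannSphere) : ∀ᶠ y in 𝓝[≠] x, HolomorphicExtEqAt η ψ y := by
  obtain ⟨P, hP, hPh, -⟩ := hψ
  have : ∀ᶠ y in 𝓝[≠] x, y ∉ P := by
    rw [eventually_nhdsWithin_iff]
    filter_upwards [(hP.sdiff (t := {x})).isClosed.isOpen_compl.mem_nhds (by simp)] with y hy hyx hyP
    exact hy ⟨hyP, hyx⟩
  exact this.mono fun y hy => (hPh y hy).self_of_nhds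

/-- Membership in `J` says that the new section is `a • σ` for a scalar `a` at each point near `x`,
off `x`. Eliminating `a` between the two components gives the relation needed for the meromorphy of
`h`; solving the second component for `a` gives the spanning. -/
theorem meromorphicAt_and_spans (hη : η.IsSmooth) (hζ₁ : IsCanonicalSection ζ₁ d₁)
    (hζ₂ : IsCanonicalSection ζ₂ d₂) (hf : ContMDiff 𝓘(ℝ, ℂ) 𝓘(ℝ, ℂ) ∞ f)
    (hfm : IsMeromorphicExtSection η (fun x => (f x • ζ₁ x, ζ₂ x))) (hJ : IsLineSubbundle η J)
    (hJne : ∀ x, ∀ᶠ y in 𝓝[≠] x, J y ≠ firstSummand L₁ L₂ y)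
    (hh : ∀ y ≠ OnePoint.infty, J y ≠ firstSummand L₁ L₂ y →
      ((f y + h y) • ζ₁ y, ζ₂ y) ∈ J y) (x : RiemannSphere) :
    MeromorphicAt (h ∘ (chartAt ℂ x).symm) (chartAt ℂ x x) ∧
      ∃ (m : ℤ) (σ : ∀ x, L₁ x × L₂ x), HolomorphicExtAt η σ x ∧
      (∀ᶠ y in 𝓝 x, σ y ≠ 0 ∧ J y = Submodule.span ℂ {σ y}) ∧
      ∀ᶠ y in 𝓝[≠] x, ((f y + h y) • ζ₁ y, ζ₂ y) =
        (chartAt ℂ x y - chartAt ℂ x x) ^ m • σ y := by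
  obtain ⟨e₁, δ₁, h₁, hζe₁⟩ := hζ₁.exists_frame x
  obtain ⟨e₂, δ₂, h₂, hζe₂⟩ := hζ₂.exists_frame x
  obtain ⟨K, -, hK⟩ := hη.exists_coefficient h₁ h₂
  obtain ⟨σ, hσ, hσJ⟩ := hJ x
  obtain ⟨S₁, S₂, hS⟩ := exists_coefficients h₁ h₂ σ
  have hiff := eventually_eq_firstSummand_iff h₂ hσJ hS
  have hPS := (holomorphicExtAt_iff h₁ h₂ hK hS).1 hσ
  have han := PlanarHolomorphicAt.analyticAt_snd hPS
  have hsrc : ∀ᶠ y in 𝓝[≠] x, y ∈ (chartAt ℂ x).source :=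
    mem_nhdsWithin_of_mem_nhds ((chartAt ℂ x).open_source.mem_nhds (mem_chart_source ℂ x))
  have hS2 : ∀ᶠ y in 𝓝[≠] x, S₂ (chartAt ℂ x y) ≠ 0 := by
    filter_upwards [hiff.filter_mono nhdsWithin_le_nhds, hJne x] with y hy hy'
      using fun h0 => hy' (hy.2 h0)
  have hnz : ¬ ∀ᶠ w in 𝓝 (chartAt ℂ x x), S₂ w = 0 := fun h0 => by
    have h0' : ∀ᶠ y in 𝓝[≠] x, S₂ (chartAt ℂ x y) = 0 :=
      (eventually_nhds_chart_iff.1 h0).filter_mono nhdsWithin_le_nhds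
    obtain ⟨y, hy1, hy2⟩ := (h0'.and hS2).exists
    exact hy2 hy1
  obtain ⟨n, t, ht, ht0, hSt⟩ := han.exists_eventuallyEq_pow_smul_nonzero_iff.2 hnz
  simp only [smul_eq_mul] at hSt
  have hninf : ∀ᶠ y in 𝓝[≠] x, y ≠ OnePoint.infty := by
    rw [eventually_nhdsWithin_iff]
    by_cases hx : x = OnePoint.infty
    · exact Eventually.of_forall fun y hy => hx ▸ hy
    · filter_upwards [isOpen_ne.mem_nhds hx] with y hy _ using hy
  have hmem : ∀ᶠ y in 𝓝[≠] x, ∃ a : ℂ,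
      (f y + h y) * (chartAt ℂ x y - chartAt ℂ x x) ^ δ₁ = a * S₁ (chartAt ℂ x y) ∧
      (chartAt ℂ x y - chartAt ℂ x x) ^ δ₂ = a * S₂ (chartAt ℂ x y) ∧
      ((f y + h y) • ζ₁ y, ζ₂ y) = a • σ y := by
    filter_upwards [hninf, hJne x, hσJ.filter_mono nhdsWithin_le_nhds,
      hS.filter_mono nhdsWithin_le_nhds, hζe₁, hζe₂, h₁.filter_mono nhdsWithin_le_nhds,
      h₂.filter_mono nhdsWithin_le_nhds] with y hy1 hy2 hy3 hy4 hy5 hy6 hy7 hy8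
    have := hh y hy1 hy2
    rw [hy3.2, Submodule.mem_span_singleton] at this
    obtain ⟨a, ha⟩ := this
    refine ⟨a, ?_, ?_, ha.symm⟩
    · have h := congrArg Prod.fst ha
      rw [hy4, hy5] at h
      simp only [Prod.smul_mk, smul_smul] at h
      exact (smul_left_cancel_of_ne_zero hy7.2 h).symm
    · have h := congrArg Prod.snd ha
      rw [hy4, hy6] at h
      simp only [Prod.smul_mk, smul_smul] at h
      exact (smul_left_cancel_of_ne_zero hy8.2 h).symm
  constructor
  · have hFx := contMDiffAt_iff_contDiffAt_chart.1 (hf x)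
    refine meromorphicAt_of_planarHolomorphic (F := f ∘ (chartAt ℂ x).symm) (δ₁ := δ₁) (δ₂ := δ₂)
      hPS ht ht0 hSt hFx.continuousAt ?_ ?_
    · refine (eventually_nhdsNE_holomorphicExtEqAt_iff h₁ h₂ hK
        (ψ := fun x => (f x • ζ₁ x, ζ₂ x)) ?_).1 (eventually_holomorphicExtEqAt hfm x)
      filter_upwards [hζe₁, hζe₂, hsrc] with y hy1 hy2 hy3
      rw [hy1, hy2, smul_smul, Function.comp_apply, (chartAt ℂ x).left_inv hy3]
    · refine eventually_nhdsNE_chart_iff.2 ?_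
      filter_upwards [hmem, hsrc] with y ⟨a, ha1, ha2, _⟩ hy
      simp only [Function.comp_apply, (chartAt ℂ x).left_inv hy]
      rw [ha1, ha2]
      ring
  -- From `c ^ δ₂ = a S₂` and `S₂ = c ^ n t` one gets `a = c ^ (δ₂ - n) t⁻¹`. The unit `t⁻¹` is
  -- absorbed into the generator.
  · refine ⟨δ₂ - n, fun y => (t (chartAt ℂ x y))⁻¹ • σ y, ?_, ?_, ?_⟩
    · refine (holomorphicExtAt_iff h₁ h₂ hK (u₁ := fun w => (t w)⁻¹ * S₁ w)
        (u₂ := fun w => (t w)⁻¹ * S₂ w) ?_).2 ?_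
      · filter_upwards [hS] with y hy
        rw [hy, Prod.smul_mk, smul_smul, smul_smul]
      · filter_upwards [hPS, ht.eventually_analyticAt, ht.continuousAt.eventually_ne ht0]
          with w hw1 hw2 hw3 using hw1.holomorphic_mul (hw2.inv hw3)
    · filter_upwards [hσJ, eventually_nhds_chart_iff.1 (ht.continuousAt.eventually_ne ht0)]
        with y hy1 hy2
      refine ⟨smul_ne_zero (inv_ne_zero hy2) hy1.1, ?_⟩
      rw [hy1.2, Submodule.span_singleton_smul_eq (inv_ne_zero hy2).isUnit]
    · filter_upwards [hmem, hS2, (eventually_nhds_chart_iff.1 hSt).filter_mono nhdsWithin_le_nhds,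
        (eventually_nhdsNE_chart_iff (x := x) (p := fun w => w ≠ chartAt ℂ x x)).1
          self_mem_nhdsWithin,
        (eventually_nhds_chart_iff.1 (ht.continuousAt.eventually_ne ht0)).filter_mono
          nhdsWithin_le_nhds] with y ⟨a, _, ha2, ha3⟩ hy1 hy2 hy3 hy4
      rw [ha3, smul_smul]
      congr 1
      have hc0 : chartAt ℂ x y - chartAt ℂ x x ≠ 0 := sub_ne_zero.2 hy3
      rw [zpow_sub₀ hc0, ha2, hy2, zpow_natCast]
      have := pow_ne_zero n hc0
      field_simp

/-- At a finite point where `J ≠ L₁` the generator has `S₂ ≠ 0`, and matching second components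
forces the section to be `S₂⁻¹ • σ`, at the point itself too. Hence the exceptional set is finite.
-/
theorem holomorphicExtAt_of_ne (hη : η.IsSmooth) (hζ₁ : IsCanonicalSection ζ₁ d₁)
    (hζ₂ : IsCanonicalSection ζ₂ d₂) (hJ : IsLineSubbundle η J)
    (hh : ∀ y ≠ OnePoint.infty, J y ≠ firstSummand L₁ L₂ y →
      ((f y + h y) • ζ₁ y, ζ₂ y) ∈ J y) (x : RiemannSphere) (hx : x ≠ OnePoint.infty)
    (hxJ : J x ≠ firstSummand L₁ L₂ x) :
    HolomorphicExtAt η (fun x => ((f x + h x) • ζ₁ x, ζ₂ x)) x := by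
  have h₁ := hζ₁.isFrameAt hx
  have h₂ := hζ₂.isFrameAt hx
  obtain ⟨K, -, hK⟩ := hη.exists_coefficient h₁ h₂
  obtain ⟨σ, hσ, hσJ⟩ := hJ x
  obtain ⟨S₁, S₂, hS⟩ := exists_coefficients h₁ h₂ σ
  have hiff := eventually_eq_firstSummand_iff h₂ hσJ hS
  have hPS := (holomorphicExtAt_iff h₁ h₂ hK hS).1 hσ
  have han := PlanarHolomorphicAt.analyticAt_snd hPS
  have hS0 : S₂ (chartAt ℂ x x) ≠ 0 := fun h0 => hxJ (hiff.self_of_nhds.2 h0)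
  have hne := han.continuousAt.eventually_ne hS0
  refine (holomorphicExtAt_iff h₁ h₂ hK (u₁ := fun w => (S₂ w)⁻¹ * S₁ w)
    (u₂ := fun w => (S₂ w)⁻¹ * S₂ w) ?_).2 ?_
  · filter_upwards [hS, hσJ, hiff, h₁, h₂, eventually_nhds_chart_iff.1 hne,
      (isOpen_ne.mem_nhds hx : _ ∈ 𝓝 x)] with y hy1 hy2 hy3 hy4 hy5 hy6 hy7
    have := hh y hy7 fun h0 => hy6 (hy3.1 h0)
    rw [hy2.2, Submodule.mem_span_singleton] at this
    obtain ⟨a, ha⟩ := this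
    have ha2 := congrArg Prod.snd ha
    rw [hy1] at ha2
    simp only [Prod.smul_mk, smul_smul] at ha2
    have ha3 : a * S₂ (chartAt ℂ x y) = 1 :=
      smul_left_cancel_of_ne_zero hy5.2 (ha2.trans (one_smul ℂ _).symm)
    rw [← ha, hy1, eq_inv_of_mul_eq_one_left ha3, Prod.smul_mk, smul_smul, smul_smul]
  · filter_upwards [hPS, han.eventually_analyticAt, hne]
      with w hw1 hw2 hw3 using hw1.holomorphic_mul (hw2.inv hw3)

theorem exists_meromorphic_spanning (hη : η.IsSmooth) (hζ₁ : IsCanonicalSection ζ₁ d₁)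
    (hζ₂ : IsCanonicalSection ζ₂ d₂) (hf : ContMDiff 𝓘(ℝ, ℂ) 𝓘(ℝ, ℂ) ∞ f)
    (hfm : IsMeromorphicExtSection η (fun x => (f x • ζ₁ x, ζ₂ x)))
    (hJ : IsLineSubbundle η J) (hne : J ≠ firstSummand L₁ L₂) :
    ∃ h : RiemannSphere → ℂ, IsMeromorphicFunction h ∧
      IsMeromorphicExtSection η (fun x => ((f x + h x) • ζ₁ x, ζ₂ x)) ∧
      SpansLineSubbundle η (fun x => ((f x + h x) • ζ₁ x, ζ₂ x)) J := by
  have hJne := hJ.eventually_ne_firstSummand hη hne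
  have hex : ∀ y, ∃ c : ℂ, y ≠ OnePoint.infty → J y ≠ firstSummand L₁ L₂ y →
      ((f y + c) • ζ₁ y, ζ₂ y) ∈ J y := fun y => by
    by_cases hy : y ≠ OnePoint.infty ∧ J y ≠ firstSummand L₁ L₂ y
    · obtain ⟨c, hc⟩ := hJ.exists_mem (ζ₂ := ζ₂) hζ₁ f hy.1 hy.2
      exact ⟨c, fun _ _ => hc⟩
    -- The default `0` is used at `N` and where `J = L₁`: finitely many points, whose values do not
    -- matter for a meromorphic function.
    · exact ⟨0, fun h1 h2 => absurd ⟨h1, h2⟩ hy⟩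
  choose h hh using hex
  have key := meromorphicAt_and_spans hη hζ₁ hζ₂ hf hfm hJ hJne hh
  refine ⟨h, fun x => (key x).1, ?_, fun x => (key x).2⟩
  refine ⟨{y | J y = firstSummand L₁ L₂ y} ∪ {OnePoint.infty},
    (finite_of_eventually_notMem hJne).union (Set.finite_singleton _), fun x hx => ?_,
    fun x _ => ?_⟩
  · rw [Set.mem_union, not_or] at hx
    exact holomorphicExtAt_of_ne hη hζ₁ hζ₂ hJ hh x hx.2 hx.1
  · obtain ⟨m, σ, h1, h2, h3⟩ := (key x).2
    exact ⟨m, σ, ⟨h1, h2.self_of_nhds.1⟩, h3⟩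

end Sphere

section Existence

/-! ### The equation `∂̄f = -β` on the sphere -/

theorem hasCompactSupport_of_eventually_cobounded {b : ℂ → ℂ}
    (h : ∀ᶠ z in Bornology.cobounded ℂ, b z = 0) : HasCompactSupport b := by
  rw [hasCompactSupport_iff_eventuallyEq, coclosedCompact_eq_cocompact,
    ← Metric.cobounded_eq_cocompact]
  exact h

/-- A function with a limit at infinity that is holomorphic near infinity. -/
theorem analyticAt_inv_of_tendsto_zero {k : ℂ → ℂ} (hk : ContDiff ℝ ∞ k)
    (hk0 : ∀ᶠ z in Bornology.cobounded ℂ, planarDbar k z = 0)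
    (hlim : Tendsto k (Bornology.cobounded ℂ) (𝓝 0)) {κ : ℂ → ℂ} (hκ0 : κ 0 = 0)
    (hκ : ∀ w ≠ 0, κ w = k w⁻¹) : AnalyticAt ℂ κ 0 := by
  refine Complex.analyticAt_of_differentiable_on_punctured_nhds_of_continuousAt ?_ ?_
  · filter_upwards [tendsto_inv₀_nhdsNE_zero.eventually hk0, self_mem_nhdsWithin] with w hw hw0
    have h1 : DifferentiableAt ℂ k w⁻¹ :=
      differentiableAt_of_planarDbar_eq_zero hk.contDiffAt.differentiableAt_real hw
    refine (h1.comp w (differentiableAt_inv hw0)).congr_of_eventuallyEq ?_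
    filter_upwards [isOpen_ne.mem_nhds hw0] with v hv using hκ v hv
  · rw [continuousAt_iff_punctured_nhds, hκ0]
    refine (hlim.comp tendsto_inv₀_nhdsNE_zero).congr' ?_
    filter_upwards [self_mem_nhdsWithin] with w hw using (hκ w hw).symm

/-- The global planar problem: a function `f = F` on `ℂ` with `∂f/∂z̄ = -B`, extending to
infinity as `w ↦ κ w + p w`, where `p (1 / z)` is a given solution near infinity. -/
theorem exists_global_solution {B p : ℂ → ℂ} (hB : ContDiff ℝ ∞ B) (hp : ContDiff ℝ ∞ p)
    (hpB : ∀ᶠ z in Bornology.cobounded ℂ, planarDbar (fun z => p z⁻¹) z = -B z) :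
    ∃ F κ : ℂ → ℂ, ContDiff ℝ ∞ F ∧ (∀ z, planarDbar F z = -B z) ∧ AnalyticAt ℂ κ 0 ∧
      ∀ᶠ w in 𝓝[≠] (0 : ℂ), F w⁻¹ = κ w + p w := by
  obtain ⟨χ, hχ, hχc, hχ1, -⟩ := exists_smooth_cutoff
    (p := fun _ => True) (Filter.Eventually.of_forall fun _ => trivial)
  -- The given solution near infinity, cut off near `0`, where `p z⁻¹` need not be smooth.
  let F₀ : ℂ → ℂ := fun z => (1 - χ z) * p z⁻¹
  have hF₀ : ContDiff ℝ ∞ F₀ := by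
    rw [contDiff_iff_contDiffAt]
    intro z
    by_cases hz : z = 0
    · subst hz
      refine contDiffAt_const (c := (0 : ℂ)) |>.congr_of_eventuallyEq ?_
      filter_upwards [hχ1] with z hz
      simp [F₀, hz]
    · exact (contDiffAt_const.sub hχ.contDiffAt).mul
        (hp.contDiffAt.comp z (contDiffAt_inv ℝ hz))
  have hχ0 : ∀ᶠ z in Bornology.cobounded ℂ, z ∉ tsupport χ :=
    hχc.isCompact.isBounded
  have hF₀p : ∀ᶠ z in Bornology.cobounded ℂ, F₀ =ᶠ[𝓝 z] fun z => p z⁻¹ := by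
    filter_upwards [hχ0] with z hz
    filter_upwards [(isClosed_tsupport χ).isOpen_compl.mem_nhds hz] with t ht
    simp [F₀, image_eq_zero_of_notMem_tsupport ht]
  -- Near infinity `F₀` already solves the equation, so the remaining error has compact support and
  -- the Cauchy transform applies.
  have hb0 : ∀ᶠ z in Bornology.cobounded ℂ, -(B z + planarDbar F₀ z) = 0 := by
    filter_upwards [hF₀p, hpB] with z hz1 hz2
    rw [hz1.planarDbar_eq, hz2]
    ring
  obtain ⟨k, hk, hkb, hklim⟩ := exists_planarDbar_eq (hB.add (contDiff_planarDbar hF₀)).neg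
    (hasCompactSupport_of_eventually_cobounded hb0)
  refine ⟨fun z => F₀ z + k z, fun w => if w = 0 then 0 else k w⁻¹, hF₀.add hk, fun z => ?_, ?_, ?_⟩
  · rw [planarDbar_add hF₀.contDiffAt.differentiableAt_real hk.contDiffAt.differentiableAt_real,
      hkb]
    ring
  · refine analyticAt_inv_of_tendsto_zero hk ?_ hklim (if_pos rfl) fun w hw => if_neg hw
    filter_upwards [hb0] with z hz
    rw [hkb]
    exact hz
  · filter_upwards [tendsto_inv₀_nhdsNE_zero.eventually hF₀p, self_mem_nhdsWithin] with w hw hw0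
    have hw0 : w ≠ 0 := hw0
    have hw1 : F₀ w⁻¹ = p w := by simpa using hw.self_of_nhds
    rw [if_neg hw0, hw1, add_comm]

end Existence

/-! ### Existence of the smooth meromorphic section -/

section SphereExistence

variable {L₁ L₂ : RiemannSphere → Type*}
  [∀ x, AddCommGroup (L₁ x)] [∀ x, Module ℂ (L₁ x)] [∀ x, TopologicalSpace (L₁ x)]
  [TopologicalSpace (TotalSpace ℂ L₁)] [FiberBundle ℂ L₁] [VectorBundle ℂ ℂ L₁]
  [ContMDiffVectorBundle ω ℂ L₁ 𝓘(ℂ)]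
  [∀ x, AddCommGroup (L₂ x)] [∀ x, Module ℂ (L₂ x)] [∀ x, TopologicalSpace (L₂ x)]
  [TopologicalSpace (TotalSpace ℂ L₂)] [FiberBundle ℂ L₂] [VectorBundle ℂ ℂ L₂]
  [ContMDiffVectorBundle ω ℂ L₂ 𝓘(ℂ)]
  {ζ₁ : ∀ x, L₁ x} {ζ₂ : ∀ x, L₂ x} {d₁ d₂ : ℤ} {η : Form01Hom L₁ L₂}

namespace RiemannSphere

theorem coordVector_of_ne {x y : RiemannSphere} (hx : x ≠ OnePoint.infty)
    (hy : y ≠ OnePoint.infty) : coordVector x y = 1 := by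
  have hs : y ∈ (chartAt ℂ x).source := by
    rw [chartAt_of_ne hx]
    exact hy
  rw [coordVector_eq_deriv hs, chartAt_of_ne hx, chartAt_of_ne hy]
  exact deriv_id _

theorem tendsto_coe_nhdsNE_infty :
    Tendsto (fun z : ℂ => (z : RiemannSphere)) (Bornology.cobounded ℂ)
      (𝓝[≠] (OnePoint.infty : RiemannSphere)) := by
  refine tendsto_nhdsWithin_iff.2 ⟨?_, Eventually.of_forall fun z => OnePoint.coe_ne_infty z⟩
  rw [Metric.cobounded_eq_cocompact, ← coclosedCompact_eq_cocompact]
  exact OnePoint.tendsto_coe_infty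

end RiemannSphere

/-- The coefficient of `η` in the frames `ζ₁`, `ζ₂` and the coordinate `z`. -/
theorem exists_affine_coefficient (hη : η.IsSmooth) (hζ₁ : IsCanonicalSection ζ₁ d₁)
    (hζ₂ : IsCanonicalSection ζ₂ d₂) :
    ∃ B : ℂ → ℂ, ContDiff ℝ ∞ B ∧ ∀ x ≠ OnePoint.infty, ∀ᶠ y in 𝓝 x,
      η y (coordVector x y) (ζ₂ y) = B (chartAt ℂ x y) • ζ₁ y := by
  have hex : ∀ z : ℂ, ∃ c : ℂ,
      η (z : RiemannSphere) (coordVector (z : RiemannSphere) z) (ζ₂ z) = c • ζ₁ z := fun z =>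
    exists_eq_smul_of_ne_zero (hζ₁.ne_zero _ (OnePoint.coe_ne_infty z)) _
  choose B hB using hex
  -- All finite points share the chart `z`, so the coordinate vectors are all `1` and one function
  -- `B` serves at every base point.
  have key : ∀ x ≠ OnePoint.infty, ∀ y ≠ (OnePoint.infty : RiemannSphere),
      η y (coordVector x y) (ζ₂ y) = B (chartAt ℂ x y) • ζ₁ y := by
    intro x hx y hy
    rw [RiemannSphere.chartAt_of_ne hx]
    induction y using OnePoint.rec with
    | infty => exact absurd rfl hy
    | coe z =>
      have h := hB z
      rw [RiemannSphere.coordVector_of_ne hy hy] at h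
      rw [RiemannSphere.coordVector_of_ne hx hy]
      exact h
  refine ⟨B, ?_, fun x hx => ?_⟩
  · rw [contDiff_iff_contDiffAt]
    intro z
    have hz : (z : RiemannSphere) ≠ OnePoint.infty := OnePoint.coe_ne_infty z
    obtain ⟨K, hKs, hK⟩ := hη.exists_coefficient (hζ₁.isFrameAt hz) (hζ₂.isFrameAt hz)
    have hc : chartAt ℂ (z : RiemannSphere) (z : RiemannSphere) = z := by
      rw [RiemannSphere.chartAt_of_ne hz]
      rfl
    have hKB : ∀ᶠ w in 𝓝 (chartAt ℂ (z : RiemannSphere) (z : RiemannSphere)), B w = K w := by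
      refine eventually_nhds_chart_iff.2 ?_
      filter_upwards [hK, isOpen_ne.mem_nhds hz] with y hy hyne
      exact smul_left_cancel_of_ne_zero (hζ₁.ne_zero y hyne) ((key _ hz y hyne).symm.trans hy)
    rw [hc] at hKB hKs
    exact hKs.self_of_nhds.congr_of_eventuallyEq hKB
  · filter_upwards [isOpen_ne.mem_nhds hx] with y hy using key x hx y hy

theorem exists_smooth_meromorphic_section (hd : 0 ≤ d₂ - d₁) (hη : η.IsSmooth)
    (hζ₁ : IsCanonicalSection ζ₁ d₁) (hζ₂ : IsCanonicalSection ζ₂ d₂) :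
    ∃ f : RiemannSphere → ℂ, ContMDiff 𝓘(ℝ, ℂ) 𝓘(ℝ, ℂ) ∞ f ∧
      IsMeromorphicExtSection η (fun x => (f x • ζ₁ x, ζ₂ x)) := by
  obtain ⟨n, hn⟩ : ∃ n : ℕ, d₂ = d₁ + n := ⟨(d₂ - d₁).toNat, by omega⟩
  obtain ⟨B, hB, hBη⟩ := exists_affine_coefficient hη hζ₁ hζ₂
  obtain ⟨e₁, he₁, he₁0, hζe₁⟩ := hζ₁.order_north
  obtain ⟨e₂, he₂, he₂0, hζe₂⟩ := hζ₂.order_north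
  have h₁ := he₁.isFrameAt he₁0
  have h₂ := he₂.isFrameAt he₂0
  obtain ⟨K, hKs, hK⟩ := hη.exists_coefficient h₁ h₂
  have hc : chartAt ℂ (OnePoint.infty : RiemannSphere) OnePoint.infty = 0 := by
    rw [RiemannSphere.chartAt_infty]
    rfl
  rw [hc] at hKs
  obtain ⟨g, hg, hgK⟩ := exists_planarDbar_eq_neg_near_zero hKs
  -- The first coefficient of `w ^ d₂ (g e₁, e₂)` in the frame `ζ₁`, since `ζ₁ = w ^ d₁ e₁`. It is
  -- smooth at `0` because `n` is a natural number.
  let p : ℂ → ℂ := fun w => w ^ n * g w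
  have hp : ContDiff ℝ ∞ p := (contDiff_id.pow n).mul hg
  -- the local solution near infinity
  have hψ₀ : ∀ᶠ y in 𝓝[≠] (OnePoint.infty : RiemannSphere), HolomorphicExtEqAt η
      (fun y => (p (RiemannSphere.wChart y) • ζ₁ y, ζ₂ y)) y := by
    refine (eventually_nhdsNE_holomorphicExtEqAt_iff h₁ h₂ hK (u₁ := fun w => w ^ d₂ * g w)
      (u₂ := fun w => w ^ d₂ * 1) ?_).2 ?_
    · filter_upwards [hζe₁, hζe₂, (eventually_nhdsNE_chart_iff (x := OnePoint.infty)
        (p := fun w => w ≠ 0)).1 (by rw [hc]; exact self_mem_nhdsWithin)] with y hy₁ hy₂ hy0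
      rw [RiemannSphere.chartAt_infty] at hy0 ⊢
      rw [hy₁, hy₂, smul_smul, mul_one, hn, zpow_add₀ hy0, zpow_natCast]
      congr 2
      simp only [p]
      ring
    · rw [hc]
      filter_upwards [hgK.filter_mono nhdsWithin_le_nhds, self_mem_nhdsWithin] with w hw hw0
      refine PlanarHolomorphicAt.holomorphic_mul (a := fun w => w ^ d₂)
        ⟨hg.contDiffAt, contDiffAt_const, ?_, planarDbar_const 1 w⟩ (analyticAt_id.zpow hw0)
      rw [hw]
      ring
  -- The same section, now read in the frames `ζ₁`, `ζ₂` and the coordinate `z`. Passing through the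
  -- section avoids computing how `K` transforms into `B`.
  have hpB : ∀ᶠ z in Bornology.cobounded ℂ, planarDbar (fun z => p z⁻¹) z = -B z := by
    filter_upwards [RiemannSphere.tendsto_coe_nhdsNE_infty.eventually hψ₀] with z hz
    have hne : (z : RiemannSphere) ≠ OnePoint.infty := OnePoint.coe_ne_infty z
    have hiff := (eventually_holomorphicExtEqAt_iff (hζ₁.isFrameAt hne) (hζ₂.isFrameAt hne)
      (hBη _ hne)).self_of_nhds (fun z => p z⁻¹) (fun _ => 1)
      (fun y => (p (RiemannSphere.wChart y) • ζ₁ y, ζ₂ y)) ?_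
    · have h := (hiff.1 hz).2.2.1
      rw [one_mul, RiemannSphere.chartAt_of_ne hne] at h
      exact eq_neg_of_add_eq_zero_left h
    · filter_upwards [isOpen_ne.mem_nhds hne] with t ht
      rw [RiemannSphere.chartAt_of_ne hne, one_smul]
      induction t using OnePoint.rec with
      | infty => exact absurd rfl ht
      | coe z => rfl
  obtain ⟨F, κ, hF, hFB, hκ, hFκ⟩ := exists_global_solution hB hp hpB
  -- The value at `N` is that of `κ + p` at `0`, so that `f` is smooth there in the coordinate `w`.
  let f : RiemannSphere → ℂ := fun x => x.elim (κ 0 + p 0) F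
  have hf_infty : ∀ᶠ w in 𝓝 (0 : ℂ), f (RiemannSphere.wChart.symm w) = κ w + p w := by
    rw [eventually_nhdsWithin_iff] at hFκ
    filter_upwards [hFκ] with w hw
    by_cases hw0 : w = 0
    · rw [hw0, RiemannSphere.wChart_symm_zero]
      rfl
    · rw [RiemannSphere.wChart_symm_of_ne hw0, ← hw hw0]
      rfl
  refine ⟨f, fun x => ?_, {OnePoint.infty}, Set.finite_singleton _, fun x hx => ?_, ?_⟩
  · rw [contMDiffAt_iff_contDiffAt_chart]
    by_cases hx : x = OnePoint.infty
    · subst hx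
      rw [hc, RiemannSphere.chartAt_infty]
      exact (hκ.contDiffAt_real.add hp.contDiffAt).congr_of_eventuallyEq hf_infty
    · rw [RiemannSphere.chartAt_of_ne hx]
      exact hF.contDiffAt
  · have hx : x ≠ OnePoint.infty := hx
    refine (holomorphicExtAt_iff (hζ₁.isFrameAt hx) (hζ₂.isFrameAt hx) (hBη x hx) (u₁ := F)
      (u₂ := fun _ => 1) ?_).2 (Eventually.of_forall fun z =>
        ⟨hF.contDiffAt, contDiffAt_const, ?_, planarDbar_const 1 z⟩)
    · filter_upwards [isOpen_ne.mem_nhds hx] with t ht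
      rw [RiemannSphere.chartAt_of_ne hx, one_smul]
      induction t using OnePoint.rec with
      | infty => exact absurd rfl ht
      | coe z => rfl
    · rw [hFB]
      ring
  · rintro x rfl
    obtain ⟨m, s₁, s₂, hs, hs0, hsm⟩ := exists_regular_representative hκ hg hgK hn
    refine ⟨m, fun y => (s₁ (RiemannSphere.wChart y) • e₁ y, s₂ (RiemannSphere.wChart y) • e₂ y),
      ⟨(holomorphicExtAt_iff h₁ h₂ hK (u₁ := s₁) (u₂ := s₂) ?_).2 (by rwa [hc]), ?_⟩, ?_⟩
    · rw [RiemannSphere.chartAt_infty]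
      exact Eventually.of_forall fun y => rfl
    · intro h
      rcases hs0 with h0 | h0
      · exact h0 (smul_eq_zero_of_fiber he₁0 (congrArg Prod.fst h))
      · exact h0 (smul_eq_zero_of_fiber he₂0 (congrArg Prod.snd h))
    · rw [hc, RiemannSphere.chartAt_infty]
      have hsm' := (eventually_nhdsNE_chart_iff (x := (OnePoint.infty : RiemannSphere))
        (p := fun w => (κ w + w ^ n * g w) * w ^ d₁ = w ^ m * s₁ w ∧ w ^ d₂ = w ^ m * s₂ w)).1
        (by rwa [hc])
      have hf' := (eventually_nhds_chart_iff (x := (OnePoint.infty : RiemannSphere))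
        (p := fun w => f (RiemannSphere.wChart.symm w) = κ w + p w)).1 (by rwa [hc])
      rw [RiemannSphere.chartAt_infty] at hsm' hf'
      filter_upwards [hsm', hf'.filter_mono nhdsWithin_le_nhds, hζe₁, hζe₂,
        mem_nhdsWithin_of_mem_nhds ((chartAt ℂ (OnePoint.infty : RiemannSphere)).open_source.mem_nhds
          (mem_chart_source ℂ (OnePoint.infty : RiemannSphere)))] with y hy1 hy2 hy3 hy4 hy5
      rw [RiemannSphere.chartAt_infty] at hy5
      rw [RiemannSphere.wChart.left_inv hy5] at hy2
      rw [hy2, hy3, hy4, sub_zero, Prod.smul_mk, smul_smul, smul_smul, smul_smul, ← hy1.1, ← hy1.2]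

end SphereExistence

end

theorem mainTheorem9
    {L₁ L₂ : RiemannSphere → Type*}
    [∀ x, AddCommGroup (L₁ x)] [∀ x, Module ℂ (L₁ x)] [∀ x, TopologicalSpace (L₁ x)]
    [TopologicalSpace (TotalSpace ℂ L₁)] [FiberBundle ℂ L₁] [VectorBundle ℂ ℂ L₁]
    [ContMDiffVectorBundle ω ℂ L₁ 𝓘(ℂ)]
    [∀ x, AddCommGroup (L₂ x)] [∀ x, Module ℂ (L₂ x)] [∀ x, TopologicalSpace (L₂ x)]
    [TopologicalSpace (TotalSpace ℂ L₂)] [FiberBundle ℂ L₂] [VectorBundle ℂ ℂ L₂]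
    [ContMDiffVectorBundle ω ℂ L₂ 𝓘(ℂ)]
    (d₁ d₂ : ℤ) (hd : 2 ≤ d₂ - d₁)
    (ζ₁ : ∀ x, L₁ x) (ζ₂ : ∀ x, L₂ x)
    (hζ₁ : IsCanonicalSection ζ₁ d₁) (hζ₂ : IsCanonicalSection ζ₂ d₂)
    (η : Form01Hom L₁ L₂) (hη : η.IsSmooth) :
    (∃ f : RiemannSphere → ℂ, ContMDiff 𝓘(ℝ, ℂ) 𝓘(ℝ, ℂ) ∞ f ∧
      IsMeromorphicExtSection η (fun x => (f x • ζ₁ x, ζ₂ x))) ∧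
    ∀ f : RiemannSphere → ℂ, ContMDiff 𝓘(ℝ, ℂ) 𝓘(ℝ, ℂ) ∞ f →
      IsMeromorphicExtSection η (fun x => (f x • ζ₁ x, ζ₂ x)) →
      ∀ J : ∀ x, Submodule ℂ (L₁ x × L₂ x), IsLineSubbundle η J → J ≠ firstSummand L₁ L₂ →
        ∃ h : RiemannSphere → ℂ, IsMeromorphicFunction h ∧
          IsMeromorphicExtSection η (fun x => ((f x + h x) • ζ₁ x, ζ₂ x)) ∧
          SpansLineSubbundle η (fun x => ((f x + h x) • ζ₁ x, ζ₂ x)) J :=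
  ⟨exists_smooth_meromorphic_section (by omega) hη hζ₁ hζ₂,
    fun _ hf hfm _ hJ hne => exists_meromorphic_spanning hη hζ₁ hζ₂ hf hfm hJ hne⟩
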